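/- Let $\gamma=e^{2\pi i/3}$ and $r=2^{-2/3}$. The initial value problem (IVP) $$c'=-s^2,\quad s'=c^2,\quad c(0)=1,\ s(0)=0$$ has a unique holomorphic solution $(c,s)$ on the disc $|z|<r$, and this solution extends to a pair of elliptic functions on $\mathbb C$, again denoted $c$ and $s$, as follows. (Meromorphic functions are given the value $0$ at their poles, and removable singularities are removed.) 1. There is exactly one real $K\in(0,2)$ with $s(-K/2)=-1$, and $c(z)=s(K-z)$ for all $z$. 2. $s$ obeys Schwarz reflection in every edge of the hexagon with vertices $\pm K,\pm K\gamma,\pm K\bar\gamma$: for distinct cube roots of unity $\omega,\omega'$, if $z^*$ is the reflection of $z\in\mathbb C$ in the line through $K\omega$ and $-K\omega'$, then $s(z^*)$ is the reflection of $s(z)$ in the line $\omega\mathbb R$. 3. $3K$, $3K\gamma$ and $3K\bar\gamma$ are periods of $s$ and of $c$; the group of all periods of $s$, and likewise of $c$, is generated by the $\mathbb R$-linearly independent numbers $3K\gamma$ and $3K\bar\gamma$. Both functions have order $3$: every half-open parallelogram $\{a+3Kt\gamma+3Ku\bar\gamma:0\le t,u<1\}$, $a\in\mathbb C$, contains exactly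 three poles, counted with multiplicity. The closed parallelogram $\mathbf P$ with vertices $0,-3K,3K\gamma,3K\bar\gamma$ is a fundamental domain for the period group of $s$ and of $c$: its translates by periods cover $\mathbb C$, and no interior point of $\mathbf P$ is congruent, modulo periods, to another point of $\mathbf P$. 4. The poles of $s$ in $\mathbf P$ are exactly $-K,\ 2K\gamma,\ 2K\bar\gamma,\ K\gamma-2K,\ K\bar\gamma-2K$. Apart from poles, $s$ takes values in $\gamma\mathbb R$ on $[0,3K\gamma]\cup[-3K,3K\bar\gamma]$ and in $\bar\gamma\mathbb R$ on $[0,3K\bar\gamma]\cup[-3K,3K\gamma]$. 5. All poles and all zeros of $s$ are simple. For all sufficiently small $\varepsilon>0$, the poles of $s$ in $\mathbf P+\varepsilon$ are exactly $-K,\ 2K\gamma,\ 2K\bar\gamma$, and its zeros there are exactly $0,\ -K+K\gamma,\ -K+K\bar\gamma$. The residues of $s$ at $-K,\ 2K\gamma,\ 2K\bar\gamma$ are $-1,\ -\bar\gamma,\ -\gamma$ respectively. 6. $c$ and $s$ have the same poles, and off these poles they satisfy the IVP and $c^3+s^3=1$. -/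

import Mathlib

open Set Filter Topology Metric

noncomputable section

namespace Dixon

/-- The primitive cube root of unity `γ = exp (2πi/3)`. -/
def γ : ℂ := Complex.exp (2 * Real.pi * Complex.I / 3)

/-- Its complex conjugate. -/
def γbar : ℂ := (starRingEnd ℂ) γ

/-- The initial value problem `c' = -s²`, `s' = c²`, `c 0 = 1`, `s 0 = 0` on a set `U`,
which is always open and contains the origin in what follows; so `c` and `s` are holomorphic
on `U`. -/
def SolvesIVP (c s : ℂ → ℂ) (U : Set ℂ) : Prop :=
  c 0 = 1 ∧ s 0 = 0 ∧ ∀ z ∈ U, HasDerivAt c (-(s z) ^ 2) z ∧ HasDerivAt s ((c z) ^ 2) z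

/-- The radius `2^(-2/3)` of the disc on which the local solution is constructed. -/
def r : ℝ := (2 : ℝ) ^ (-(2 / 3) : ℝ)

/-- The set of poles of a meromorphic function. -/
def poles (f : ℂ → ℂ) : Set ℂ := {z | meromorphicOrderAt f z < 0}

/-- The set of zeros of a meromorphic function. -/
def zeros (f : ℂ → ℂ) : Set ℂ := {z | 0 < meromorphicOrderAt f z}

/-- The multiplicity of `z` as a pole of `f` (zero if `z` is not a pole). -/
def poleMultiplicity (f : ℂ → ℂ) (z : ℂ) : ℕ := (-(meromorphicOrderAt f z).untop₀).toNat

/-- `ρ` is the residue of `f` at `a`: it is the value of `1/(2πi) ∮ f` over all sufficiently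
small circles about `a`. -/
def HasResidue (f : ℂ → ℂ) (a ρ : ℂ) : Prop :=
  ∀ᶠ R : ℝ in 𝓝[>] 0, (2 * Real.pi * Complex.I)⁻¹ * (∮ z in C(a, R), f z) = ρ

/-- The set of all periods of `f`. -/
def periods (f : ℂ → ℂ) : Set ℂ := {w | Function.Periodic f w}

/-- An elliptic function: meromorphic in the whole plane, with two periods that are linearly
independent over the reals. Meromorphic functions are represented in normal form, that is, they
have the value of the analytic continuation at each removable singularity and the value `0` at each
pole, so that identities between them hold at every point. -/
def IsElliptic (f : ℂ → ℂ) : Prop :=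
  MeromorphicNFOn f univ ∧
    ∃ ω₁ ω₂ : ℂ, LinearIndependent ℝ ![ω₁, ω₂] ∧ ω₁ ∈ periods f ∧ ω₂ ∈ periods f

/-- The half-open parallelogram with corner `a` and sides `ω₁`, `ω₂`. -/
def cell (a ω₁ ω₂ : ℂ) : Set ℂ :=
  {z | ∃ t ∈ Ico (0 : ℝ) 1, ∃ u ∈ Ico (0 : ℝ) 1, z = a + t * ω₁ + u * ω₂}

/-- The period group of `f` is generated by the real-linearly independent numbers `ω₁`, `ω₂`, and
`f` has order `n`: each period cell contains exactly `n` poles, counted with multiplicity. -/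
def HasBasicPeriodsAndOrder (f : ℂ → ℂ) (ω₁ ω₂ : ℂ) (n : ℕ) : Prop :=
  LinearIndependent ℝ ![ω₁, ω₂] ∧
    periods f = (AddSubgroup.closure {ω₁, ω₂} : AddSubgroup ℂ) ∧
    ∀ a : ℂ, ∑ᶠ z ∈ cell a ω₁ ω₂, poleMultiplicity f z = n

/-- The closed set `P` is a fundamental domain for the translations by elements of `Λ`: its
translates cover the plane, and no interior point of `P` is congruent to another point of `P`. -/
def IsFundamentalDomain (P Λ : Set ℂ) : Prop :=
  IsClosed P ∧ (∀ z : ℂ, ∃ w ∈ Λ, z + w ∈ P) ∧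
    ∀ z ∈ interior P, ∀ y ∈ P, y - z ∈ Λ → y = z

/-- The closed parallelogram with vertices `0`, `-3K`, `3Kγ` and `3Kγbar`. -/
def P (K : ℝ) : Set ℂ := convexHull ℝ ({0, -3 * (K : ℂ), 3 * K * γ, 3 * K * γbar} : Set ℂ)

/-- The parallelogram `P`, translated by `ε` in the positive real direction. -/
def shiftedP (K ε : ℝ) : Set ℂ := (fun z : ℂ => z + ε) '' P K

/-- Reflexion of `z` in the line through the distinct points `p` and `q`. -/
def reflect (p q z : ℂ) : ℂ := p + (q - p) * (starRingEnd ℂ) ((z - p) / (q - p))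

end Dixon

end

/-!
The functions are written down explicitly, as one lattice sum, and every assertion is read off from
the symmetries of that sum and from Liouville's theorem; no analytic continuation is needed.

If the theorem holds, `s` has simple zeros on a lattice `K · L`, where `L` is generated by `γ - 1`
and `γbar - 1`, it has simple poles on `-K + K · L`, and it is multiplied by a character `χ` of `L`,
with values in the cube roots of unity, under translation by `K · L`. This leads to the twisted
Weierstrass-type sum
`Z w = ∑ χ(l) (1/(w-l) + 1/l + w/l²)`, which converges absolutely. In `Z (w + l) - χ(l) Z w` the
singular terms cancel one by one, so that this difference is affine in `w`. Since `χ` is invariant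
under the rotation by `γ`, while the affine terms are not, it vanishes (`Z_add`). There are no
Legendre-type quasi-period constants to be determined, and the identity holds at every point,
lattice points included: with `1/0 = 0` the same computation is valid there, and `Z` takes the value
`0` at its poles.

Liouville's theorem for functions on `ℂ/L` with removable singularities
(`exists_const_of_removable`) then gives three identities, each by inspecting one singular point:
`Z w ^ 3 + Z (-w) ^ 3` is constant (`Z_cube_add`), `Z' w = -Z (-w) ^ 2` (`deriv_Z`), and
`Z w * Z (1 - w)` is constant (`Z_mul_Z`). The first is the Fermat cubic, the second is the
differential equation, and the third locates all zeros. Put `K = -Z (-1)`, which is real by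
conjugation symmetry and positive by monotonicity of `Z` on the real axis (`K₀_pos`), and
`s z = -(1/K) Z (1 + z/K)`, `c z = s (K - z)`.

In the real basis `γ`, `γbar` the zeros and poles of `s` are `K (p γ + q γbar)` with `p + q ≡ 0`
and `p + q ≡ 2` modulo `3`, and the periods are those with `p` and `q` both divisible by `3`; all
statements about parallelograms become statements about integers in intervals. The reflections
combine conjugation, rotation and translation symmetry. The bounds `1 ≤ K < 2` follow from the mean
value theorem and `c³ + s³ = 1`, and the uniqueness statement for the initial value problem from
uniqueness for ordinary differential equations along rays.
-/

noncomputable section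

namespace Dixon

/-! ### The cube roots of unity -/

lemma γ_eq : γ = -1 / 2 + (√3 / 2 : ℝ) * Complex.I := by
  have h : (2 * Real.pi * Complex.I / 3 : ℂ) = ((Real.pi - Real.pi / 3 : ℝ) : ℂ) * Complex.I := by
    push_cast; ring
  rw [γ, h, Complex.exp_mul_I, ← Complex.ofReal_cos, ← Complex.ofReal_sin, Real.cos_pi_sub,
    Real.sin_pi_sub, Real.cos_pi_div_three, Real.sin_pi_div_three]
  push_cast; ring

lemma γ_re : γ.re = -1 / 2 := by rw [γ_eq]; simp
lemma γ_im : γ.im = √3 / 2 := by rw [γ_eq]; simp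

lemma γbar_re : γbar.re = -1 / 2 := by rw [γbar, Complex.conj_re, γ_re]
lemma γbar_im : γbar.im = -(√3 / 2) := by rw [γbar, Complex.conj_im, γ_im]

@[simp] lemma conj_γ : (starRingEnd ℂ) γ = γbar := rfl
@[simp] lemma conj_γbar : (starRingEnd ℂ) γbar = γ := Complex.conj_conj γ

lemma γbar_eq : γbar = -1 - γ := by
  apply Complex.ext
  · simp [γbar_re, γ_re]; norm_num
  · simp [γbar_im, γ_im]

lemma γ_sq : γ ^ 2 = -1 - γ := by
  have h3 : √3 * √3 = 3 := Real.mul_self_sqrt (by norm_num)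
  apply Complex.ext
  · simp [pow_two, γ_re, γ_im]; linarith
  · simp [pow_two, γ_re, γ_im]; ring

lemma γ_sq_eq : γ ^ 2 = γbar := by rw [γ_sq, γbar_eq]

lemma γ_cube : γ ^ 3 = 1 := by linear_combination (γ - 1) * γ_sq

lemma γ_ne_zero : γ ≠ 0 := Complex.exp_ne_zero _

lemma γ_ne_one : γ ≠ 1 := fun h => by
  have := congrArg Complex.re h
  rw [γ_re] at this; norm_num at this

lemma cube_eq_one_iff {ω : ℂ} : ω ^ 3 = 1 ↔ ω = 1 ∨ ω = γ ∨ ω = γbar := by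
  have h : ω ^ 3 - 1 = (ω - 1) * ((ω - γ) * (ω - γbar)) := by
    rw [γbar_eq]; linear_combination (ω - 1) * γ_sq
  rw [← sub_eq_zero, h, mul_eq_zero, mul_eq_zero, sub_eq_zero, sub_eq_zero, sub_eq_zero]

/-! ### Coordinates with respect to the real basis `γ`, `γbar` -/

/-- The coefficient of `γ` when `z` is written in the real basis `γ`, `γbar`. -/
def coordX (z : ℂ) : ℝ := -z.re + z.im / √3

/-- The coefficient of `γbar` when `z` is written in the real basis `γ`, `γbar`. -/
def coordY (z : ℂ) : ℝ := -z.re - z.im / √3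

lemma coord_eq (z : ℂ) : z = coordX z * γ + coordY z * γbar := by
  have h3 : √3 ≠ 0 := by positivity
  apply Complex.ext
  · simp [coordX, coordY, γ_re, γbar_re]; ring
  · simp [coordX, coordY, γ_im, γbar_im]; field_simp; ring

lemma coordX_comb (x y : ℝ) : coordX (x * γ + y * γbar) = x := by
  have h3 : √3 ≠ 0 := by positivity
  simp [coordX, γ_re, γbar_re, γ_im, γbar_im]; field_simp; ring

lemma coordY_comb (x y : ℝ) : coordY (x * γ + y * γbar) = y := by
  have h3 : √3 ≠ 0 := by positivity
  simp [coordY, γ_re, γbar_re, γ_im, γbar_im]; field_simp; ring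

lemma comb_inj {x y x' y' : ℝ} : (x * γ + y * γbar : ℂ) = x' * γ + y' * γbar ↔ x = x' ∧ y = y' := by
  refine ⟨fun h => ⟨?_, ?_⟩, fun h => by rw [h.1, h.2]⟩
  · rw [← coordX_comb x y, h, coordX_comb]
  · rw [← coordY_comb x y, h, coordY_comb]

lemma intComb_inj {p q p' q' : ℤ} :
    (p * γ + q * γbar : ℂ) = p' * γ + q' * γbar ↔ p = p' ∧ q = q' := by
  have := comb_inj (x := p) (y := q) (x' := p') (y' := q')
  simpa using this

/-! ### The lattice of zeros and its character -/

/-- The lattice generated by `γ - 1` and `γbar - 1`. -/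
def L : PeriodPair where
  ω₁ := γ - 1
  ω₂ := γbar - 1
  indep := by
    refine LinearIndependent.pair_iff.2 fun a b h => ?_
    have h' : ((2 * a + b : ℝ) * γ + (a + 2 * b : ℝ) * γbar : ℂ) =
        (0 : ℝ) * γ + (0 : ℝ) * γbar := by
      simp only [Complex.real_smul] at h
      push_cast
      rw [γbar_eq] at h ⊢
      linear_combination h
    obtain ⟨h1, h2⟩ := comb_inj.1 h'
    constructor <;> linarith

/-- In the basis `γ`, `γbar`, the lattice consists of the integer points whose coordinate sum is
divisible by `3`. -/
lemma mem_L {z : ℂ} : z ∈ L.lattice ↔ ∃ p q : ℤ, 3 ∣ p + q ∧ z = p * γ + q * γbar := by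
  rw [PeriodPair.mem_lattice]
  constructor
  · rintro ⟨m, n, rfl⟩
    refine ⟨2 * m + n, m + 2 * n, ⟨m + n, by ring⟩, ?_⟩
    simp only [L]; push_cast; rw [γbar_eq]; ring
  · rintro ⟨p, q, ⟨k, hk⟩, rfl⟩
    refine ⟨p - k, q - k, ?_⟩
    have hk' : (p + q : ℂ) = 3 * k := by exact_mod_cast hk
    simp only [L]; push_cast; rw [γbar_eq]; linear_combination -hk'

lemma intComb_mem_L {p q : ℤ} : (p * γ + q * γbar : ℂ) ∈ L.lattice ↔ 3 ∣ p + q := by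
  rw [mem_L]
  refine ⟨?_, fun h => ⟨p, q, h, rfl⟩⟩
  rintro ⟨p', q', h, e⟩
  obtain ⟨rfl, rfl⟩ := intComb_inj.1 e
  exact h

lemma γ_mul_mem_L {z : ℂ} (hz : z ∈ L.lattice) : γ * z ∈ L.lattice := by
  obtain ⟨p, q, h, rfl⟩ := mem_L.1 hz
  have : γ * (p * γ + q * γbar) = ((-q : ℤ) : ℂ) * γ + ((p - q : ℤ) : ℂ) * γbar := by
    push_cast; rw [γbar_eq]; linear_combination (p - q) * γ_sq
  rw [this, intComb_mem_L]; omega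

lemma conj_mem_L {z : ℂ} (hz : z ∈ L.lattice) : (starRingEnd ℂ) z ∈ L.lattice := by
  obtain ⟨p, q, h, rfl⟩ := mem_L.1 hz
  have : (starRingEnd ℂ) (p * γ + q * γbar) = q * γ + p * γbar := by simp; ring
  rw [this, intComb_mem_L]; omega

/-- The unitary character of `ℂ` that takes the value `γ` at `γ - 1` and is trivial on the reals.
Restricted to the lattice `L` it takes values in the cube roots of unity. -/
def χ (z : ℂ) : ℂ := Complex.exp ((4 * Real.pi / (3 * √3) * z.im : ℝ) * Complex.I)

lemma χ_add (z w : ℂ) : χ (z + w) = χ z * χ w := by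
  rw [χ, χ, χ, ← Complex.exp_add]; congr 1; simp; ring

@[simp] lemma χ_zero : χ 0 = 1 := by simp [χ]

lemma χ_ne_zero (z : ℂ) : χ z ≠ 0 := Complex.exp_ne_zero _

@[simp] lemma norm_χ (z : ℂ) : ‖χ z‖ = 1 := Complex.norm_exp_ofReal_mul_I _

lemma χ_conj (z : ℂ) : χ ((starRingEnd ℂ) z) = (starRingEnd ℂ) (χ z) := by
  rw [χ, χ, ← Complex.exp_conj]; congr 1
  rw [map_mul, Complex.conj_ofReal, Complex.conj_I, Complex.conj_im]; push_cast; ring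

lemma χ_neg (z : ℂ) : χ (-z) = (χ z)⁻¹ := by
  rw [χ, χ, ← Complex.exp_neg]; congr 1; simp

lemma χ_intComb (p q : ℤ) : χ (p * γ + q * γbar) = γ ^ (p - q) := by
  rw [χ, γ, ← Complex.exp_int_mul]
  congr 1
  have h : (p * γ + q * γbar : ℂ).im = (p - q) * (√3 / 2) := by
    simp [γ_im, γbar_im]; ring
  rw [← γ, h]
  have h3 : √3 ≠ 0 := by positivity
  have : (4 * Real.pi / (3 * √3) * ((p - q) * (√3 / 2)) : ℝ) = 2 * Real.pi / 3 * (p - q) := by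
    field_simp; ring
  rw [this]; push_cast; ring

lemma γ_zpow_three_mul (n : ℤ) : γ ^ (3 * n) = 1 := by
  rw [zpow_mul]; norm_cast; rw [γ_cube, one_zpow]

lemma γ_zpow_eq_of_dvd {m n : ℤ} (h : 3 ∣ m - n) : γ ^ m = γ ^ n := by
  obtain ⟨k, hk⟩ := h
  rw [show m = n + 3 * k by omega, zpow_add₀ γ_ne_zero, γ_zpow_three_mul, mul_one]

lemma γ_zpow_eq_one_iff {n : ℤ} : γ ^ n = 1 ↔ 3 ∣ n := by
  refine ⟨fun h => ?_, fun h => by simpa using γ_zpow_eq_of_dvd (n := 0) (by simpa using h)⟩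
  have h3 : n % 3 = 0 ∨ n % 3 = 1 ∨ n % 3 = 2 := by omega
  rw [γ_zpow_eq_of_dvd (n := n % 3) (by omega)] at h
  rcases h3 with h3 | h3 | h3
  · omega
  · rw [h3, zpow_one] at h; exact (γ_ne_one h).elim
  · rw [h3] at h
    have h2 : γ ^ 2 = 1 := by exact_mod_cast h
    refine (γ_ne_one ?_).elim
    linear_combination γ_cube - γ * h2

lemma χ_γ_mul {l : ℂ} (hl : l ∈ L.lattice) : χ (γ * l) = χ l := by
  obtain ⟨p, q, h, rfl⟩ := mem_L.1 hl
  have : γ * (p * γ + q * γbar) = ((-q : ℤ) : ℂ) * γ + ((p - q : ℤ) : ℂ) * γbar := by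
    push_cast; rw [γbar_eq]; linear_combination (p - q) * γ_sq
  rw [this, χ_intComb, χ_intComb]
  exact γ_zpow_eq_of_dvd (by omega)

lemma χ_cube {l : ℂ} (hl : l ∈ L.lattice) : χ l ^ 3 = 1 := by
  obtain ⟨p, q, h, rfl⟩ := mem_L.1 hl
  rw [χ_intComb, ← zpow_natCast, ← zpow_mul, mul_comm]
  exact_mod_cast γ_zpow_three_mul (p - q)

lemma χ_eq_one_iff {p q : ℤ} : χ (p * γ + q * γbar) = 1 ↔ 3 ∣ p - q := by
  rw [χ_intComb, γ_zpow_eq_one_iff]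

lemma γ_sub_one_mem : γ - 1 ∈ L.lattice := L.ω₁_mem_lattice

lemma χ_γ_sub_one : χ (γ - 1) = γ := by
  have : γ - 1 = ((2 : ℤ) : ℂ) * γ + ((1 : ℤ) : ℂ) * γbar := by
    push_cast; rw [γbar_eq]; ring
  rw [this, χ_intComb]; norm_num

/-- Nonzero integer combinations of `γ` and `γbar` have norm at least `1`. -/
lemma one_le_norm_intComb {p q : ℤ} (h : ¬ (p = 0 ∧ q = 0)) : 1 ≤ ‖(p * γ + q * γbar : ℂ)‖ := by
  have h3 : √3 * √3 = 3 := Real.mul_self_sqrt (by norm_num)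
  have hn : Complex.normSq (p * γ + q * γbar) = ((p * p - p * q + q * q : ℤ) : ℝ) := by
    rw [Complex.normSq_apply]
    simp [γ_re, γbar_re, γ_im, γbar_im]
    linear_combination (p - q : ℝ) ^ 2 / 4 * h3
  have hpos : 1 ≤ p * p - p * q + q * q := by
    by_contra hlt
    have h0 : (2 * p - q) ^ 2 + 3 * q ^ 2 ≤ 0 := by nlinarith
    have hq : q = 0 := by nlinarith [sq_nonneg (2 * p - q), sq_nonneg q]
    subst hq
    exact h ⟨by nlinarith [sq_nonneg p], rfl⟩
  have : (1 : ℝ) ≤ ‖(p * γ + q * γbar : ℂ)‖ ^ 2 := by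
    rw [← Complex.normSq_eq_norm_sq, hn]; exact_mod_cast hpos
  nlinarith [norm_nonneg (p * γ + q * γbar : ℂ)]

/-! ### The character-twisted lattice sum -/

/-- The lattice sum `∑ χ(l) (1/(w-l) + 1/l + w/l²)`. It has simple poles at the lattice points.
Since `1/0 = 0`, the term at `l = 0` is `1/w`, and the value at each lattice point is that of
the sum without its singular term. -/
def Z (w : ℂ) : ℂ := ∑' l : L.lattice, χ l * (1 / (w - l) + 1 / l + w / (l : ℂ) ^ 2)

/-- The remainder `∑ χ(l) / (l² (w-l))`, for which `Z w = 1/w + w² E w` near the origin. The term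
at `l = 0` vanishes because `1/0 = 0`. -/
def E (w : ℂ) : ℂ := ∑' l : L.lattice, χ l / ((l : ℂ) ^ 2 * (w - l))

lemma E_summand_bound {r : ℝ} (hr : 0 < r) {w : ℂ} (hw : ‖w‖ < r) {l : ℂ} (hl : 2 * r ≤ ‖l‖) :
    ‖χ l / (l ^ 2 * (w - l))‖ ≤ 2 * ‖l‖ ^ (-3 : ℝ) := by
  have hl0 : 0 < ‖l‖ := by linarith
  have h1 : ‖l‖ / 2 ≤ ‖w - l‖ := by
    rw [norm_sub_rev]; exact .trans (by linarith) (norm_sub_norm_le l w)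
  calc ‖χ l / (l ^ 2 * (w - l))‖ = 1 / (‖l‖ ^ 2 * ‖w - l‖) := by simp
    _ ≤ 1 / (‖l‖ ^ 2 * (‖l‖ / 2)) := by gcongr
    _ = 2 / ‖l‖ ^ 3 := by field_simp
    _ = 2 * ‖l‖ ^ (-3 : ℝ) := by
      rw [Real.rpow_neg hl0.le, div_eq_mul_inv]; norm_cast

lemma hasSumLocallyUniformly_E :
    HasSumLocallyUniformly (fun (l : L.lattice) (w : ℂ) => χ l / ((l : ℂ) ^ 2 * (w - l))) E := by
  refine L.hasSumLocallyUniformly_aux _ (u := fun _ l => 2 * ‖l‖ ^ (-3 : ℝ))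
    (fun _ _ => (ZLattice.summable_norm_rpow _ _ (by simp; norm_num)).mul_left _) fun r hr =>
    eventually_atTop.mpr ⟨2 * r, ?_⟩
  rintro _ h s hs l rfl
  exact E_summand_bound hr hs h

lemma differentiableOn_E : DifferentiableOn ℂ E ((L.lattice : Set ℂ) \ {0})ᶜ := by
  refine hasSumLocallyUniformly_E.hasSumLocallyUniformlyOn.differentiableOn
    (.of_forall fun s => .fun_sum fun l _ => ?_) L.isOpen_compl_lattice_sdiff
  by_cases hl : (l : ℂ) = 0
  · simp [hl]
  · refine .div (by fun_prop) (by fun_prop) fun w hw h => ?_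
    have h' : w = l := by simpa [hl, sub_eq_zero] using h
    exact hw ⟨h' ▸ l.2, by simpa [h'] using hl⟩

lemma analyticAt_E {w : ℂ} (hw : w ∉ L.lattice ∨ w = 0) : AnalyticAt ℂ E w := by
  refine differentiableOn_E.analyticAt (L.isOpen_compl_lattice_sdiff.mem_nhds ?_)
  rintro ⟨h1, h2⟩
  exact hw.elim (fun h => h h1) (fun h => h2 h)

lemma summable_E (w : ℂ) : Summable fun l : L.lattice => χ l / ((l : ℂ) ^ 2 * (w - l)) :=
  (hasSumLocallyUniformly_E.hasSum (x := w)).summable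

lemma Z_summand_eq {w l : ℂ} (hl : l ≠ 0) (hw : w ≠ l) :
    χ l * (1 / (w - l) + 1 / l + w / l ^ 2) = w ^ 2 * (χ l / (l ^ 2 * (w - l))) := by
  have : w - l ≠ 0 := sub_ne_zero.2 hw
  field_simp; ring

lemma summable_Z (w : ℂ) :
    Summable fun l : L.lattice => χ l * (1 / (w - l) + 1 / l + w / (l : ℂ) ^ 2) := by
  refine ((summable_E w).mul_left (w ^ 2)).congr_cofinite ?_
  have hfin : {l : L.lattice | (l : ℂ) = 0 ∨ (l : ℂ) = w}.Finite := by
    refine ((Set.finite_singleton (0 : ℂ)).union (Set.finite_singleton w)).preimage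
      (Subtype.val_injective.injOn) |>.subset ?_
    rintro l (h | h) <;> simp [h]
  filter_upwards [hfin.compl_mem_cofinite] with l hl
  have hl' : ¬ ((l : ℂ) = 0 ∨ (l : ℂ) = w) := hl
  push Not at hl'
  exact (Z_summand_eq hl'.1 (Ne.symm hl'.2)).symm

lemma Z_eq {w : ℂ} (hw : w ∉ L.lattice ∨ w = 0) : Z w = 1 / w + w ^ 2 * E w := by
  classical
  have h := (summable_Z w).tsum_eq_add_tsum_ite 0
  rw [Z, h, E, ← tsum_mul_left]
  congr 1
  · simp
  · refine tsum_congr fun l => ?_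
    by_cases hl : l = 0
    · simp [hl]
    · have hl' : (l : ℂ) ≠ 0 := by simpa using hl
      rw [if_neg hl]
      by_cases hwl : w = l
      · rcases hw with hw | hw
        · exact (hw (hwl ▸ l.2)).elim
        · exact (hl' (hwl ▸ hw)).elim
      exact Z_summand_eq hl' hwl

lemma analyticAt_Z {w : ℂ} (hw : w ∉ L.lattice) : AnalyticAt ℂ Z w := by
  have hw0 : w ≠ 0 := fun h => hw (h ▸ L.lattice.zero_mem)
  have h : AnalyticAt ℂ (fun w => 1 / w + w ^ 2 * E w) w :=
    (analyticAt_const.div analyticAt_id hw0).add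
      ((analyticAt_id.pow 2).mul (analyticAt_E (.inl hw)))
  refine h.congr ?_
  filter_upwards [L.isClosed_lattice.isOpen_compl.mem_nhds hw] with x hx
  exact (Z_eq (.inl hx)).symm

/-! ### Symmetries of the lattice sum -/

/-- Multiplication by `γ` as a permutation of the lattice. -/
def rotEquiv : L.lattice ≃ L.lattice where
  toFun l := ⟨γ * l, γ_mul_mem_L l.2⟩
  invFun l := ⟨γ * (γ * l), γ_mul_mem_L (γ_mul_mem_L l.2)⟩
  left_inv l := by ext; simp only; linear_combination (l : ℂ) * γ_cube
  right_inv l := by ext; simp only; linear_combination (l : ℂ) * γ_cube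

/-- Complex conjugation as a permutation of the lattice. -/
def conjEquiv : L.lattice ≃ L.lattice where
  toFun l := ⟨(starRingEnd ℂ) l, conj_mem_L l.2⟩
  invFun l := ⟨(starRingEnd ℂ) l, conj_mem_L l.2⟩
  left_inv l := by ext; simp
  right_inv l := by ext; simp

lemma Z_γ_mul (w : ℂ) : Z (γ * w) = γ ^ 2 * Z w := by
  rw [Z, ← rotEquiv.tsum_eq, Z, ← tsum_mul_left]
  refine tsum_congr fun l => ?_
  have h1 : γ⁻¹ = γ ^ 2 := inv_eq_of_mul_eq_one_right (by linear_combination γ_cube)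
  have h2 : (γ ^ 2)⁻¹ = γ := inv_eq_of_mul_eq_one_right (by linear_combination γ_cube)
  simp only [rotEquiv, Equiv.coe_fn_mk, χ_γ_mul l.2, ← mul_sub, mul_inv, div_eq_mul_inv,
    mul_pow, h1, h2]
  ring

lemma Z_conj (w : ℂ) : Z ((starRingEnd ℂ) w) = (starRingEnd ℂ) (Z w) := by
  rw [Z, ← conjEquiv.tsum_eq, Z, Complex.conj_tsum]
  refine tsum_congr fun l => ?_
  simp [conjEquiv, χ_conj]

lemma Z_zero : Z 0 = 0 := by
  have h : (1 - γ ^ 2) * Z 0 = 0 := by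
    have := Z_γ_mul 0
    rw [mul_zero] at this
    linear_combination this
  rcases mul_eq_zero.1 h with h | h
  · refine (γ_ne_one ?_).elim
    linear_combination γ * h + γ_cube
  · exact h

/-- The defect from quasi-periodicity is an affine function of `w`, because the singular terms
cancel in the difference of the two sums. -/
lemma exists_Z_add (l : L.lattice) : ∃ A B : ℂ, ∀ w, Z (w + l) = χ l * Z w + (A + B * w) := by
  have key : ∀ w : ℂ, HasSum (fun m : L.lattice => χ l * χ m * (1 / ((m : ℂ) + l) - 1 / m +
      l / ((m : ℂ) + l) ^ 2) + (χ l * χ m * (1 / ((m : ℂ) + l) ^ 2 - 1 / (m : ℂ) ^ 2)) * w)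
      (Z (w + l) - χ l * Z w) := by
    intro w
    have h1 := ((Equiv.addRight l).hasSum_iff).2 (summable_Z (w + l)).hasSum
    have h2 := (summable_Z w).hasSum.mul_left (χ l)
    refine (h1.sub h2).congr_fun fun m => ?_
    simp only [Function.comp, Equiv.coe_addRight, Submodule.coe_add, χ_add]
    rw [show w + (l : ℂ) - (m + l) = w - m by ring]
    ring
  refine ⟨Z (0 + l) - χ l * Z 0, Z (1 + l) - χ l * Z 1 - (Z (0 + l) - χ l * Z 0), fun w => ?_⟩
  have h0 := key 0
  have h1 := (key 1).sub h0
  have h0' : HasSum (fun m : L.lattice => χ l * χ m * (1 / ((m : ℂ) + l) - 1 / m +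
      l / ((m : ℂ) + l) ^ 2)) (Z (0 + l) - χ l * Z 0) := by simpa using h0
  have h1' : HasSum (fun m : L.lattice => χ l * χ m * (1 / ((m : ℂ) + l) ^ 2 - 1 / (m : ℂ) ^ 2))
      (Z (1 + l) - χ l * Z 1 - (Z (0 + l) - χ l * Z 0)) := by simpa using h1
  have := (key w).unique (h0'.add (h1'.mul_right w))
  linear_combination this

/-- Quasi-periodicity. Comparing `Z (w + l + m)` for the two orders of adding shows that the affine
defects form a coboundary, and the rotation by `γ`, which leaves `χ` invariant, forces it to
vanish. -/
lemma Z_add {l : ℂ} (hl : l ∈ L.lattice) (w : ℂ) : Z (w + l) = χ l * Z w := by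
  choose A B h using exists_Z_add
  let m : L.lattice := ⟨γ - 1, γ_sub_one_mem⟩
  have hm : χ m = γ := χ_γ_sub_one
  have comm : ∀ (l : L.lattice) (w : ℂ), χ l * (A m + B m * w) + (A l + B l * (w + m)) =
      γ * (A l + B l * w) + (A m + B m * (w + l)) := by
    intro l w
    have e1 : Z (w + m + l) = _ := h l (w + m)
    have e2 : Z (w + l + m) = _ := h m (w + l)
    rw [h m w] at e1
    rw [h l w] at e2
    rw [add_right_comm, e1, hm] at e2
    linear_combination e2
  have rot : ∀ (l : L.lattice) (w : ℂ), γ ^ 2 * (A l + B l * w) =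
      A (rotEquiv l) + B (rotEquiv l) * (γ * w) := by
    intro l w
    have e1 : Z (γ * w + γ * l) = χ (γ * l) * _ + _ := h (rotEquiv l) (γ * w)
    rw [← mul_add, Z_γ_mul, Z_γ_mul, h l w, χ_γ_mul l.2] at e1
    linear_combination e1
  have hγ : 1 - γ ≠ 0 := sub_ne_zero.2 γ_ne_one.symm
  have hB : ∀ l, B l = 0 := by
    intro l
    have c0 := comm l 0
    have c1 := comm l 1
    have c2 := comm (rotEquiv l) 0
    have c3 := comm (rotEquiv l) 1
    have r0 := rot l 0
    have r1 := rot l 1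
    have hχ : χ (rotEquiv l) = χ l := χ_γ_mul l.2
    rw [hχ] at c2 c3
    have e1 : (1 - γ) * (B (rotEquiv l) - B l) = 0 := by linear_combination c3 - c2 - c1 + c0
    have e2 : B (rotEquiv l) = B l := by
      rcases mul_eq_zero.1 e1 with e | e
      · exact (hγ e).elim
      · exact sub_eq_zero.1 e
    have e3 : (1 - γ) * (γ * B l) = 0 := by
      rw [e2] at r0 r1
      linear_combination r0 - r1
    simpa [hγ, γ_ne_zero] using e3
  have hA : A ⟨l, hl⟩ = 0 := by
    have c0 := comm ⟨l, hl⟩ 0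
    have c2 := comm (rotEquiv ⟨l, hl⟩) 0
    have r0 := rot ⟨l, hl⟩ 0
    have hχ : χ (rotEquiv ⟨l, hl⟩) = χ l := χ_γ_mul hl
    rw [hχ] at c2
    simp only [hB] at c0 c2 r0
    have e1 : (1 - γ) * (A (rotEquiv ⟨l, hl⟩) - A ⟨l, hl⟩) = 0 := by linear_combination c2 - c0
    have e2 : A (rotEquiv ⟨l, hl⟩) = A ⟨l, hl⟩ := by
      rcases mul_eq_zero.1 e1 with e | e
      · exact (hγ e).elim
      · exact sub_eq_zero.1 e
    have e3 : (1 - γ) * (γ ^ 2 * A ⟨l, hl⟩) = 0 := by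
      linear_combination r0 + e2 + A ⟨l, hl⟩ * (1 - γ) * γ_sq
    simpa [hγ, γ_ne_zero] using e3
  have := h ⟨l, hl⟩ w
  rw [hA, hB] at this
  simpa using this

/-! ### Liouville's theorem for functions with removable singularities -/

/-- `f` agrees with a function analytic at `w` on a punctured neighbourhood of `w`. -/
def Removable (f : ℂ → ℂ) (w : ℂ) : Prop := ∃ h : ℂ → ℂ, AnalyticAt ℂ h w ∧ f =ᶠ[𝓝[≠] w] h

lemma tendsto_add_nhdsNE (w l : ℂ) : Tendsto (fun x => x + l) (𝓝[≠] w) (𝓝[≠] (w + l)) :=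
  ((continuous_id.add continuous_const).continuousWithinAt).tendsto_nhdsWithin
    fun x hx => by simpa using hx

lemma tendsto_const_sub_nhdsNE (a w : ℂ) : Tendsto (fun x => a - x) (𝓝[≠] w) (𝓝[≠] (a - w)) :=
  ((continuous_const.sub continuous_id).continuousWithinAt).tendsto_nhdsWithin
    fun x hx => by simpa using hx

lemma Removable.add {f : ℂ → ℂ} {w l e : ℂ} (h : Removable f w) (hf : ∀ x, f (x + l) = e * f x) :
    Removable f (w + l) := by
  obtain ⟨h, ha, he⟩ := h
  refine ⟨fun x => e * h (x - l), analyticAt_const.mul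
    (ha.comp_of_eq (analyticAt_id.sub analyticAt_const) (by simp)), ?_⟩
  have ht := tendsto_add_nhdsNE (w + l) (-l)
  rw [add_neg_cancel_right] at ht
  filter_upwards [ht.eventually he] with x hx
  rw [← sub_eq_add_neg] at hx
  rw [← hx, ← hf, sub_add_cancel]

/-- A function whose singularities are all removable and whose absolute value is periodic for the
lattice is constant. -/
theorem exists_const_of_removable {f : ℂ → ℂ} (hf : ∀ w, Removable f w)
    (hper : ∀ l ∈ L.lattice, ∀ w, ‖f (w + l)‖ = ‖f w‖) :
    ∃ C, ∀ w, ContinuousAt f w → f w = C := by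
  choose h ha he using hf
  -- `x ↦ h x x` fills in all singularities at once
  have key : ∀ w, (fun x => h x x) =ᶠ[𝓝 w] h w := by
    intro w
    have h1 : ∀ᶠ x in 𝓝 w, AnalyticAt ℂ (h w) x := (ha w).eventually_analyticAt
    have h2 := eventually_nhdsWithin_iff.1 (eventually_eventually_nhdsWithin.2 (he w))
    filter_upwards [h1, h2] with x hx1 hx2
    by_cases hxw : x = w
    · rw [hxw]
    · have h3 : f =ᶠ[𝓝 x] h w := by
        have := hx2 hxw
        rwa [isOpen_compl_singleton.nhdsWithin_eq hxw] at this
      have h4 : h x =ᶠ[𝓝[≠] x] h w := (he x).symm.trans (h3.filter_mono nhdsWithin_le_nhds)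
      exact (((ha x).continuousAt.eventuallyEq_nhds_iff_eventuallyEq_nhdsNE
        hx1.continuousAt).1 h4).eq_of_nhds
  have hd : Differentiable ℂ fun x => h x x := fun w =>
    ((ha w).congr (key w).symm).differentiableAt
  have hlim : ∀ w, Tendsto f (𝓝[≠] w) (𝓝 (h w w)) := fun w =>
    ((ha w).continuousAt.tendsto.mono_left nhdsWithin_le_nhds).congr' (he w).symm
  have hp : ∀ w l, l ∈ L.lattice → ‖h (w + l) (w + l)‖ = ‖h w w‖ := by
    intro w l hl
    have h1 := ((hlim (w + l)).comp (tendsto_add_nhdsNE w l)).norm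
    have h2 := (hlim w).norm
    refine tendsto_nhds_unique h1 (h2.congr fun x => ?_)
    exact (hper l hl x).symm
  have hc := IsZLattice.isCompact_range_of_periodic L.lattice _ hd.continuous.norm hp
  have hb : Bornology.IsBounded (range fun x => h x x) := by
    obtain ⟨R, hR⟩ := hc.isBounded.exists_norm_le
    refine isBounded_iff_forall_norm_le.2 ⟨R, ?_⟩
    rintro _ ⟨x, rfl⟩
    simpa using hR _ ⟨x, rfl⟩
  refine ⟨h 0 0, fun w hw => ?_⟩
  rw [← hd.apply_eq_apply_of_bounded hb w 0]
  exact tendsto_nhds_unique (hw.tendsto.mono_left nhdsWithin_le_nhds) (hlim w)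

lemma exists_const_of_removable_zero {f : ℂ → ℂ} (ha : ∀ w ∉ L.lattice, AnalyticAt ℂ f w)
    (h0 : Removable f 0) (e : ℂ → ℂ) (he : ∀ l, ‖e l‖ = 1)
    (hper : ∀ l ∈ L.lattice, ∀ w, f (w + l) = e l * f w) :
    ∃ C, ∀ w ∉ L.lattice, f w = C := by
  have hrem : ∀ w, Removable f w := fun w => by
    by_cases hw : w ∈ L.lattice
    · simpa using h0.add (hper w hw)
    · exact ⟨f, ha w hw, EventuallyEq.rfl⟩
  obtain ⟨C, hC⟩ := exists_const_of_removable hrem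
    (fun l hl w => by rw [hper l hl, norm_mul, he, one_mul])
  exact ⟨C, fun w hw => hC w (ha w hw).continuousAt⟩

/-! ### Identities for the lattice sum -/

lemma intCast_mem_L {n : ℤ} : (n : ℂ) ∈ L.lattice ↔ 3 ∣ n := by
  have : (n : ℂ) = ((-n : ℤ) : ℂ) * γ + ((-n : ℤ) : ℂ) * γbar := by
    push_cast; rw [γbar_eq]; ring
  rw [this, intComb_mem_L]; omega

lemma one_notMem_L : (1 : ℂ) ∉ L.lattice := by
  have := intCast_mem_L (n := 1)
  rw [Int.cast_one] at this
  rw [this]; norm_num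

lemma three_mem_L : (3 : ℂ) ∈ L.lattice := by
  have := intCast_mem_L (n := 3)
  norm_num at this; exact this

lemma add_mem_L_iff {w l : ℂ} (hl : l ∈ L.lattice) : w + l ∈ L.lattice ↔ w ∈ L.lattice :=
  L.lattice.add_mem_iff_left hl

lemma neg_mem_L_iff {w : ℂ} : -w ∈ L.lattice ↔ w ∈ L.lattice := neg_mem_iff

@[simp] lemma χ_ofReal (x : ℝ) : χ x = 1 := by simp [χ]

@[simp] lemma χ_three : χ 3 = 1 := by simpa using χ_ofReal 3

lemma Z_sub {l : ℂ} (hl : l ∈ L.lattice) (w : ℂ) : Z (w - l) = (χ l)⁻¹ * Z w := by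
  rw [sub_eq_add_neg, Z_add (neg_mem hl), χ_neg]

lemma χ_inv_sq {l : ℂ} (hl : l ∈ L.lattice) : (χ l)⁻¹ ^ 2 = χ l := by
  have := χ_cube hl
  have h0 := χ_ne_zero l
  field_simp
  linear_combination -this

/-- The point `1` is the centre of a rotational symmetry for which `Z` is equivariant with a
nontrivial factor. -/
lemma Z_one : Z 1 = 0 := by
  have h1 := Z_γ_mul 1
  have h2 := Z_add γ_sub_one_mem 1
  rw [χ_γ_sub_one, show (1 : ℂ) + (γ - 1) = γ * 1 by ring, h1] at h2
  have h3 : γ * (γ - 1) * Z 1 = 0 := by linear_combination h2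
  simpa [γ_ne_zero, sub_eq_zero, γ_ne_one] using h3

lemma eventually_notMem_or_zero : ∀ᶠ w : ℂ in 𝓝 0, w ∉ L.lattice ∨ w = 0 := by
  filter_upwards [L.compl_lattice_sdiff_singleton_mem_nhds 0] with w hw
  by_contra! h
  exact hw ⟨h.1, h.2⟩

lemma eventually_notMem : ∀ᶠ w : ℂ in 𝓝[≠] 0, w ∉ L.lattice :=
  eventually_nhdsWithin_iff.2 (eventually_notMem_or_zero.mono fun _ h h0 => h.resolve_right h0)

lemma analyticAt_E_zero : AnalyticAt ℂ E 0 := analyticAt_E (.inr rfl)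

lemma analyticAt_E_neg_zero : AnalyticAt ℂ (fun w => E (-w)) 0 :=
  analyticAt_E_zero.comp_of_eq analyticAt_id.neg (by simp)

lemma analyticAt_Z_neg {w : ℂ} (hw : w ∉ L.lattice) : AnalyticAt ℂ (fun w => Z (-w)) w :=
  (analyticAt_Z (by rwa [neg_mem_L_iff])).comp_of_eq analyticAt_id.neg rfl

lemma Z_cube_add_aux : ∃ C, ∀ w ∉ L.lattice, Z w ^ 3 + Z (-w) ^ 3 = C := by
  refine exists_const_of_removable_zero (fun w hw => ((analyticAt_Z hw).pow 3).add
    ((analyticAt_Z_neg hw).pow 3)) ?_ (fun _ => 1) (by simp) fun l hl w => ?_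
  · refine ⟨fun w => 3 * (E w + E (-w)) + 3 * w ^ 3 * (E w ^ 2 - E (-w) ^ 2)
      + w ^ 6 * (E w ^ 3 + E (-w) ^ 3), ?_, ?_⟩
    · have := analyticAt_E_zero
      have := analyticAt_E_neg_zero
      fun_prop
    · filter_upwards [eventually_notMem, self_mem_nhdsWithin] with w hw h0
      have h0' : w ≠ 0 := h0
      rw [Z_eq (.inl hw), Z_eq (.inl (by rwa [neg_mem_L_iff]))]
      field_simp; ring
  · rw [neg_add, ← sub_eq_add_neg, Z_add hl, Z_sub hl, mul_pow, mul_pow, inv_pow, χ_cube hl]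
    simp

lemma deriv_Z_add {l : ℂ} (hl : l ∈ L.lattice) (w : ℂ) : deriv Z (w + l) = χ l * deriv Z w := by
  rw [← deriv_comp_add_const, show (fun x => Z (x + l)) = fun x => χ l * Z x from
    funext fun x => Z_add hl x, deriv_const_mul_field]

lemma deriv_Z {w : ℂ} (hw : w ∉ L.lattice) : deriv Z w = -Z (-w) ^ 2 := by
  have hper : ∀ l ∈ L.lattice, ∀ w, deriv Z (w + l) + Z (-(w + l)) ^ 2 =
      χ l * (deriv Z w + Z (-w) ^ 2) := by
    intro l hl w
    rw [neg_add, ← sub_eq_add_neg, deriv_Z_add hl, Z_sub hl, mul_pow, χ_inv_sq hl]; ring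
  have hrem : Removable (fun w => deriv Z w + Z (-w) ^ 2) 0 := by
    refine ⟨fun w => 2 * w * E w + w ^ 2 * deriv E w - 2 * w * E (-w) + w ^ 4 * E (-w) ^ 2, ?_, ?_⟩
    · have := analyticAt_E_zero
      have := analyticAt_E_neg_zero
      have := analyticAt_E_zero.deriv
      fun_prop
    · filter_upwards [eventually_notMem, self_mem_nhdsWithin] with w hw h0
      have h0' : w ≠ 0 := h0
      have hE : HasDerivAt E (deriv E w) w := (analyticAt_E (.inl hw)).differentiableAt.hasDerivAt
      have hd : HasDerivAt (fun w => w⁻¹ + w ^ 2 * E w)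
          (-(w ^ 2)⁻¹ + (2 * w * E w + w ^ 2 * deriv E w)) w :=
        ((hasDerivAt_inv h0').add ((hasDerivAt_pow 2 w).mul hE)).congr_deriv (by simp)
      have he : Z =ᶠ[𝓝 w] fun w => w⁻¹ + w ^ 2 * E w := by
        filter_upwards [L.isClosed_lattice.isOpen_compl.mem_nhds hw] with x hx
        rw [Z_eq (.inl hx), one_div]
      rw [he.deriv_eq, hd.deriv, Z_eq (.inl (by rwa [neg_mem_L_iff]))]
      field_simp; ring
  obtain ⟨C, hC⟩ := exists_const_of_removable_zero (f := fun w => deriv Z w + Z (-w) ^ 2)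
    (fun w hw => (analyticAt_Z hw).deriv.add ((analyticAt_Z_neg hw).pow 2)) hrem χ norm_χ hper
  -- the constant is multiplied by `γ` under translation by `γ - 1`
  have h1 := hper (γ - 1) γ_sub_one_mem 1
  have h2 : 1 + (γ - 1) ∉ L.lattice := by rw [add_mem_L_iff γ_sub_one_mem]; exact one_notMem_L
  rw [hC _ h2, hC _ one_notMem_L, χ_γ_sub_one] at h1
  have h3 : (γ - 1) * C = 0 := by linear_combination -h1
  have h4 : C = 0 := by simpa [sub_eq_zero, γ_ne_one] using h3
  have := hC w hw
  rw [h4] at this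
  linear_combination this

lemma hasDerivAt_Z {w : ℂ} (hw : w ∉ L.lattice) : HasDerivAt Z (-Z (-w) ^ 2) w := by
  rw [← deriv_Z hw]; exact (analyticAt_Z hw).differentiableAt.hasDerivAt

lemma neg_one_notMem_L : (-1 : ℂ) ∉ L.lattice := by rw [neg_mem_L_iff]; exact one_notMem_L

lemma two_notMem_L : (2 : ℂ) ∉ L.lattice := by
  have := intCast_mem_L (n := 2)
  norm_num at this; exact this

lemma Z_two : Z 2 = Z (-1) := by
  have := Z_add three_mem_L (-1)
  rw [χ_three, one_mul] at this
  rw [← this]; norm_num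

lemma removable_Z_mul_zero : Removable (fun w => Z w * Z (1 - w)) 0 := by
  have hg : AnalyticAt ℂ (fun w => Z (1 - w)) 0 :=
    (analyticAt_Z one_notMem_L).comp_of_eq (analyticAt_const.sub analyticAt_id) (by simp)
  have ho : ((1 : ℕ) : ℕ∞) ≤ analyticOrderAt (fun w => Z (1 - w)) 0 := by
    rw [Nat.cast_one, Order.one_le_iff_ne_zero, hg.analyticOrderAt_ne_zero]
    simp [Z_one]
  obtain ⟨k, hk, hke⟩ := (natCast_le_analyticOrderAt hg).1 ho
  refine ⟨fun w => (1 + w ^ 3 * E w) * k w, ?_, ?_⟩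
  · have := analyticAt_E_zero
    fun_prop
  · filter_upwards [eventually_notMem, self_mem_nhdsWithin, hke.filter_mono nhdsWithin_le_nhds]
      with w hw h0 hk
    have h0' : w ≠ 0 := h0
    rw [hk, Z_eq (.inl hw)]
    simp only [sub_zero, pow_one, smul_eq_mul]
    field_simp

/-- The zeros and poles of the two factors cancel. -/
lemma Z_mul_Z {w : ℂ} (hw : w ∉ L.lattice) (hw' : 1 - w ∉ L.lattice) :
    Z w * Z (1 - w) = Z (-1) ^ 2 := by
  have hper : ∀ l ∈ L.lattice, ∀ w, Z (w + l) * Z (1 - (w + l)) = 1 * (Z w * Z (1 - w)) := by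
    intro l hl w
    have := χ_ne_zero l
    rw [← sub_sub, Z_add hl, Z_sub hl]; field_simp
  have hL : ∀ w ∈ L.lattice, Removable (fun w => Z w * Z (1 - w)) w := fun w hw => by
    simpa using removable_Z_mul_zero.add (hper w hw)
  have han : ∀ w ∉ L.lattice, 1 - w ∉ L.lattice → AnalyticAt ℂ (fun w => Z w * Z (1 - w)) w :=
    fun w h h' => (analyticAt_Z h).mul
      ((analyticAt_Z h').comp_of_eq (analyticAt_const.sub analyticAt_id) rfl)
  have hrem : ∀ w, Removable (fun w => Z w * Z (1 - w)) w := fun w => by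
    by_cases h : w ∈ L.lattice
    · exact hL w h
    by_cases h' : 1 - w ∈ L.lattice
    · obtain ⟨g, hg, he⟩ := hL _ h'
      refine ⟨fun x => g (1 - x), hg.comp_of_eq (analyticAt_const.sub analyticAt_id) rfl, ?_⟩
      filter_upwards [(tendsto_const_sub_nhdsNE 1 w).eventually he] with x hx
      rw [← hx, sub_sub_cancel, mul_comm]
    · exact ⟨_, han w h h', EventuallyEq.rfl⟩
  obtain ⟨C, hC⟩ := exists_const_of_removable hrem fun l hl w => by rw [hper l hl, one_mul]
  have h1 : Z w * Z (1 - w) = C := hC w (han w hw hw').continuousAt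
  have h2 : Z (-1) * Z (1 - -1) = C :=
    hC (-1) (han _ neg_one_notMem_L (by norm_num; exact two_notMem_L)).continuousAt
  rw [h1, ← h2, sub_neg_eq_add, one_add_one_eq_two, Z_two]; ring

/-! ### The real number `K₀` -/

/-- The number that becomes the real period parameter `K`. -/
def K₀ : ℝ := -(Z (-1)).re

lemma Z_ofReal (x : ℝ) : Z x = (Z x).re := by
  have := Z_conj x
  rw [Complex.conj_ofReal] at this
  exact (Complex.conj_eq_iff_re.1 this.symm).symm

lemma Z_neg_one : Z (-1) = -(K₀ : ℂ) := by
  have := Z_ofReal (-1)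
  push_cast at this
  rw [this, K₀]; simp

lemma ofReal_mem_L {x : ℝ} (h : (x : ℂ) ∈ L.lattice) : ∃ n : ℤ, x = 3 * n := by
  obtain ⟨p, q, hpq, e⟩ := mem_L.1 h
  have e1 : ((-x : ℝ) : ℂ) * γ + ((-x : ℝ) : ℂ) * γbar =
      ((p : ℝ) : ℂ) * γ + ((q : ℝ) : ℂ) * γbar := by
    push_cast
    rw [← e, γbar_eq]; ring
  obtain ⟨h1, h2⟩ := comb_inj.1 e1
  have hpq' : p = q := by exact_mod_cast h1.symm.trans h2
  subst hpq'
  obtain ⟨n, hn⟩ : (3 : ℤ) ∣ p := by omega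
  refine ⟨-n, ?_⟩
  have : (p : ℝ) = 3 * n := by exact_mod_cast hn
  push_cast; linarith

lemma ofReal_notMem_L {x : ℝ} (h0 : 0 < x) (h3 : x < 3) : (x : ℂ) ∉ L.lattice := by
  intro h
  obtain ⟨n, rfl⟩ := ofReal_mem_L h
  have h1 : (0 : ℝ) < n := by linarith
  have h2 : (n : ℝ) < 1 := by linarith
  have h1' : 0 < n := by exact_mod_cast h1
  have h2' : n < 1 := by exact_mod_cast h2
  omega

lemma exists_Z_ne_zero {w : ℂ} (hw : w ∉ L.lattice) : ∃ᶠ x in 𝓝[≠] w, Z x ≠ 0 := by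
  intro h
  have hcount : (L.lattice : Set ℂ).Countable := by
    have : Countable L.lattice := L.latticeEquivProd.toEquiv.countable_iff.2 inferInstance
    exact Set.to_countable _
  have hpre : IsPreconnected (L.lattice : Set ℂ)ᶜ :=
    (hcount.isPathConnected_compl_of_one_lt_rank (by simp)).isConnected.isPreconnected
  have hz := AnalyticOnNhd.eqOn_zero_of_preconnected_of_frequently_eq_zero
    (f := Z) (fun x hx => analyticAt_Z hx) hpre hw (h.mono fun x hx => not_not.1 hx).frequently
  have h1 : Tendsto (fun w : ℂ => 1 + w ^ 3 * E w) (𝓝[≠] 0) (𝓝 (1 + 0 ^ 3 * E 0)) := by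
    have : ContinuousAt E 0 := analyticAt_E_zero.continuousAt
    exact (continuousAt_const.add ((continuousAt_id.pow 3).mul this)).tendsto.mono_left
      nhdsWithin_le_nhds
  have h2 : Tendsto (fun w : ℂ => 1 + w ^ 3 * E w) (𝓝[≠] 0) (𝓝 0) := by
    refine tendsto_const_nhds.congr' ?_
    filter_upwards [eventually_notMem, self_mem_nhdsWithin] with w hw h0
    have h0' : w ≠ 0 := h0
    have := hz hw
    rw [Z_eq (.inl hw)] at this
    simp only [Pi.zero_apply] at this
    field_simp at this
    rw [this, mul_zero]
  simpa using tendsto_nhds_unique h1 h2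

/-- On the real axis `Z` decreases from `Z 1 = 0` to `Z 2 = Z (-1)`, and it is not constant. -/
lemma K₀_pos : 0 < K₀ := by
  have hd : ∀ x ∈ Icc (1 : ℝ) 2, HasDerivAt (fun y : ℝ => (Z y).re) (-(Z (-x)).re ^ 2) x := by
    intro x hx
    have h := (hasDerivAt_Z (ofReal_notMem_L (x := x) (by linarith [hx.1])
      (by linarith [hx.2]))).real_of_complex
    have e := Z_ofReal (-x)
    push_cast at e
    rw [e] at h
    convert h using 1
    norm_cast
  have hanti : AntitoneOn (fun y : ℝ => (Z y).re) (Icc 1 2) := by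
    refine antitoneOn_of_deriv_nonpos (convex_Icc 1 2)
      (fun x hx => (hd x hx).continuousAt.continuousWithinAt)
      (fun x hx => (hd x (interior_subset hx)).differentiableAt.differentiableWithinAt)
      fun x hx => ?_
    rw [(hd x (interior_subset hx)).deriv]
    nlinarith [sq_nonneg (Z (-x)).re]
  have h1 : (Z (1 : ℝ)).re = 0 := by simp [Z_one]
  have h2 : (Z (2 : ℝ)).re = -K₀ := by simp [Z_two, Z_neg_one]
  have hle := hanti (left_mem_Icc.2 one_le_two) (right_mem_Icc.2 one_le_two) one_le_two
  simp only [h1, h2] at hle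
  refine lt_of_le_of_ne (by linarith) fun h0 => ?_
  have hzero : ∀ x ∈ Icc (1 : ℝ) 2, Z x = 0 := by
    intro x hx
    have a := hanti (left_mem_Icc.2 one_le_two) hx hx.1
    have b := hanti hx (right_mem_Icc.2 one_le_two) hx.2
    simp only [h1, h2] at a b
    rw [Z_ofReal, show (Z x).re = 0 by linarith, Complex.ofReal_zero]
  -- so `Z` vanishes on an interval, hence identically
  have hmem : ((3 / 2 : ℝ) : ℂ) ∉ L.lattice := ofReal_notMem_L (by norm_num) (by norm_num)
  have hcl := (analyticAt_Z hmem).eventually_eq_zero_or_eventually_ne_zero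
  rcases hcl with hc | hc
  · exact exists_Z_ne_zero hmem ((hc.filter_mono nhdsWithin_le_nhds).mono fun x hx h => h hx)
  · have ht : Tendsto (fun x : ℝ => (x : ℂ)) (𝓝[≠] (3 / 2)) (𝓝[≠] ((3 / 2 : ℝ) : ℂ)) :=
      Complex.continuous_ofReal.continuousWithinAt.tendsto_nhdsWithin fun x hx => by
        simpa [-Complex.ofReal_div] using hx
    have hI : ∀ᶠ x : ℝ in 𝓝[≠] (3 / 2), x ∈ Icc (1 : ℝ) 2 :=
      nhdsWithin_le_nhds (Icc_mem_nhds (by norm_num) (by norm_num))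
    obtain ⟨x, hx1, hx2⟩ := ((ht.eventually hc).and hI).exists
    exact hx1 (hzero x hx2)

/-- The Fermat cubic relation. -/
lemma Z_cube_add {w : ℂ} (hw : w ∉ L.lattice) : Z w ^ 3 + Z (-w) ^ 3 = -(K₀ : ℂ) ^ 3 := by
  obtain ⟨C, hC⟩ := Z_cube_add_aux
  rw [hC w hw, ← hC 1 one_notMem_L, Z_one, Z_neg_one]; ring

/-! ### The functions `sm` and `cm` -/

/-- The elliptic sine: the lattice sum `Z`, rescaled so that `sm' = 1` at the origin. -/
def sm (z : ℂ) : ℂ := -(1 / (K₀ : ℂ)) * Z (1 + z / K₀)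

/-- The elliptic cosine. -/
def cm (z : ℂ) : ℂ := sm (K₀ - z)

lemma K₀_ne_zero : (K₀ : ℂ) ≠ 0 := Complex.ofReal_ne_zero.2 K₀_pos.ne'

lemma exists_coord (z : ℂ) : ∃ x y : ℝ, z = K₀ * (x * γ + y * γbar) := by
  refine ⟨coordX (z / K₀), coordY (z / K₀), ?_⟩
  rw [← coord_eq, mul_div_cancel₀ _ K₀_ne_zero]

lemma K₀_comb_inj {x y x' y' : ℝ} :
    (K₀ * (x * γ + y * γbar) : ℂ) = K₀ * (x' * γ + y' * γbar) ↔ x = x' ∧ y = y' := by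
  rw [mul_right_inj' K₀_ne_zero, comb_inj]

/-- The points at which `sm` will turn out to have its poles. -/
def IsPolePt (z : ℂ) : Prop := 1 + z / K₀ ∈ L.lattice

lemma isPolePt_iff {z : ℂ} :
    IsPolePt z ↔ ∃ p q : ℤ, 3 ∣ p + q - 2 ∧ z = K₀ * (p * γ + q * γbar) := by
  rw [IsPolePt, mem_L]
  constructor
  · rintro ⟨p, q, h, e⟩
    refine ⟨p + 1, q + 1, by omega, ?_⟩
    have : z = K₀ * (p * γ + q * γbar - 1) := by
      rw [← e, add_sub_cancel_left, mul_div_cancel₀ _ K₀_ne_zero]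
    rw [this]; push_cast; rw [γbar_eq]; ring
  · rintro ⟨p, q, h, rfl⟩
    refine ⟨p - 1, q - 1, by omega, ?_⟩
    rw [mul_div_cancel_left₀ _ K₀_ne_zero]; push_cast; rw [γbar_eq]; ring

lemma div_K₀_mem_L_iff {z : ℂ} :
    z / K₀ ∈ L.lattice ↔ ∃ p q : ℤ, 3 ∣ p + q ∧ z = K₀ * (p * γ + q * γbar) := by
  rw [mem_L]
  simp only [div_eq_iff K₀_ne_zero, mul_comm (K₀ : ℂ)]

lemma isPolePt_intComb {p q : ℤ} : IsPolePt (K₀ * (p * γ + q * γbar)) ↔ 3 ∣ p + q - 2 := by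
  rw [isPolePt_iff]
  refine ⟨?_, fun h => ⟨p, q, h, rfl⟩⟩
  rintro ⟨p', q', h, e⟩
  rw [mul_right_inj' K₀_ne_zero, intComb_inj] at e
  obtain ⟨rfl, rfl⟩ := e
  exact h

lemma sm_add {l : ℂ} (hl : l ∈ L.lattice) (z : ℂ) : sm (z + K₀ * l) = χ l * sm z := by
  rw [sm, sm, add_div, mul_div_cancel_left₀ _ K₀_ne_zero, ← add_assoc, Z_add hl]; ring

lemma sm_γ_mul (z : ℂ) : sm (γ * z) = γ * sm z := by
  have h := Z_add γ_sub_one_mem (1 + γ * z / K₀)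
  rw [χ_γ_sub_one, show 1 + γ * z / K₀ + (γ - 1) = γ * (1 + z / K₀) by ring, Z_γ_mul] at h
  have h' : Z (1 + γ * z / K₀) = γ * Z (1 + z / K₀) :=
    mul_left_cancel₀ γ_ne_zero (by linear_combination -h)
  rw [sm, sm, h']; ring

lemma sm_γbar_mul (z : ℂ) : sm (γbar * z) = γbar * sm z := by
  rw [← γ_sq_eq, pow_two, mul_assoc, sm_γ_mul, sm_γ_mul, mul_assoc]

lemma sm_conj (z : ℂ) : sm ((starRingEnd ℂ) z) = (starRingEnd ℂ) (sm z) := by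
  rw [sm, sm, map_mul, ← Z_conj]; simp

lemma sm_ofReal (x : ℝ) : sm x = (sm x).re := by
  have := sm_conj x
  rw [Complex.conj_ofReal] at this
  exact (Complex.conj_eq_iff_re.1 this.symm).symm

lemma cm_eq (z : ℂ) : cm z = -(1 / (K₀ : ℂ)) * Z (-(1 + z / K₀)) := by
  have := Z_add three_mem_L (-(1 + z / K₀))
  rw [χ_three, one_mul] at this
  rw [cm, sm, ← this, sub_div, div_self K₀_ne_zero]; congr 2; ring

lemma cm_ofReal (x : ℝ) : cm x = (cm x).re := by
  have := sm_ofReal (K₀ - x)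
  push_cast at this
  exact this

lemma sm_zero : sm 0 = 0 := by simp [sm, Z_one]

lemma sm_K₀ : sm K₀ = 1 := by
  rw [sm, div_self K₀_ne_zero, one_add_one_eq_two, Z_two, Z_neg_one, neg_mul_neg,
    one_div_mul_cancel K₀_ne_zero]

lemma cm_zero : cm 0 = 1 := by rw [cm, sub_zero, sm_K₀]

lemma analyticAt_sm {z : ℂ} (hz : ¬ IsPolePt z) : AnalyticAt ℂ sm z :=
  analyticAt_const.mul ((analyticAt_Z hz).comp_of_eq
    (analyticAt_const.add (analyticAt_id.div analyticAt_const K₀_ne_zero)) rfl)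

lemma isPolePt_K₀_sub {z : ℂ} : IsPolePt (K₀ - z) ↔ IsPolePt z := by
  rw [IsPolePt, IsPolePt, ← neg_mem_L_iff (w := 1 + z / K₀), ← add_mem_L_iff three_mem_L (w := -_),
    sub_div, div_self K₀_ne_zero]
  ring_nf

lemma hasDerivAt_sm {z : ℂ} (hz : ¬ IsPolePt z) : HasDerivAt sm (cm z ^ 2) z := by
  have h1 : HasDerivAt (fun z : ℂ => 1 + z / K₀) (1 / (K₀ : ℂ)) z :=
    ((hasDerivAt_id z).div_const _).const_add _
  refine (((hasDerivAt_Z hz).comp z h1).const_mul (-(1 / (K₀ : ℂ)))).congr_deriv ?_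
  rw [cm_eq]; ring

lemma hasDerivAt_cm {z : ℂ} (hz : ¬ IsPolePt z) : HasDerivAt cm (-sm z ^ 2) z := by
  have h1 : HasDerivAt (fun z : ℂ => (K₀ : ℂ) - z) (-1) z := (hasDerivAt_id z).const_sub _
  refine ((hasDerivAt_sm (mt isPolePt_K₀_sub.1 hz)).comp z h1).congr_deriv ?_
  rw [cm, sub_sub_cancel]; ring

lemma cm_cube_add_sm_cube {z : ℂ} (hz : ¬ IsPolePt z) : cm z ^ 3 + sm z ^ 3 = 1 := by
  have h := Z_cube_add hz
  have hK := K₀_ne_zero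
  rw [cm_eq, sm]
  generalize Z (1 + z / K₀) = x at *
  generalize Z (-(1 + z / K₀)) = y at *
  field_simp; linear_combination -h

lemma sm_mul_sm {z : ℂ} (hz : ¬ IsPolePt z) (hz' : z / K₀ ∉ L.lattice) :
    sm z * sm (2 * K₀ - z) = 1 := by
  have hK := K₀_ne_zero
  have h := Z_mul_Z hz (by rwa [show 1 - (1 + z / K₀) = -(z / K₀) by ring, neg_mem_L_iff])
  have h3 := Z_add three_mem_L (1 - (1 + z / K₀))
  rw [χ_three, one_mul] at h3
  rw [Z_neg_one, ← h3] at h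
  rw [sm, sm, show 1 + (2 * K₀ - z) / (K₀ : ℂ) = 1 - (1 + z / K₀) + 3 by field_simp; ring]
  field_simp at h ⊢
  linear_combination h

lemma sm_eq_zero_iff {z : ℂ} (hz : ¬ IsPolePt z) : sm z = 0 ↔ z / K₀ ∈ L.lattice := by
  constructor
  · intro h
    by_contra h'
    have := sm_mul_sm hz h'
    simp [h] at this
  · intro h
    have := sm_add h 0
    rwa [zero_add, mul_div_cancel₀ _ K₀_ne_zero, sm_zero, mul_zero] at this

/-! ### Poles, zeros and residues -/

lemma sm_eq_zero_of_isPolePt {z : ℂ} (hz : IsPolePt z) : sm z = 0 := by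
  have := Z_add hz 0
  rw [zero_add, Z_zero, mul_zero] at this
  rw [sm, this, mul_zero]

/-- The principal part of `sm` at a pole. -/
lemma sm_near_pole {a : ℂ} (ha : IsPolePt a) : ∃ A : ℂ → ℂ, AnalyticAt ℂ A a ∧
    ∀ᶠ z in 𝓝[≠] a, sm z = -χ (1 + a / K₀) * (z - a)⁻¹ + A z := by
  have hK := K₀_ne_zero
  have hc : Tendsto (fun z : ℂ => (z - a) / K₀) (𝓝[≠] a) (𝓝[≠] 0) := by
    have : ContinuousWithinAt (fun z : ℂ => (z - a) / K₀) {a}ᶜ a := by fun_prop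
    have := this.tendsto_nhdsWithin (t := {0}ᶜ) fun z hz => by
      simpa [sub_eq_zero, hK] using hz
    simpa using this
  refine ⟨fun z => -(1 / (K₀ : ℂ)) * χ (1 + a / K₀) * (((z - a) / K₀) ^ 2 * E ((z - a) / K₀)),
    ?_, ?_⟩
  · have : AnalyticAt ℂ (fun z : ℂ => (z - a) / K₀) a :=
      (analyticAt_id.sub analyticAt_const).div analyticAt_const hK
    exact analyticAt_const.mul ((this.pow 2).mul
      (analyticAt_E_zero.comp_of_eq this (by simp)))
  · filter_upwards [hc.eventually eventually_notMem, self_mem_nhdsWithin] with z hz hza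
    have h0 : z - a ≠ 0 := sub_ne_zero.2 hza
    have h := Z_add ha ((z - a) / K₀)
    rw [show (z - a) / K₀ + (1 + a / K₀) = 1 + z / K₀ by ring, Z_eq (.inl hz)] at h
    rw [sm, h]
    generalize χ (1 + a / K₀) = x
    field_simp; ring

lemma sm_pole_form {a : ℂ} (ha : IsPolePt a) : ∃ g : ℂ → ℂ, AnalyticAt ℂ g a ∧ g a ≠ 0 ∧
    ∀ᶠ z in 𝓝[≠] a, sm z = (z - a) ^ (-1 : ℤ) • g z := by
  obtain ⟨A, hA, hs⟩ := sm_near_pole ha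
  refine ⟨fun z => -χ (1 + a / K₀) + (z - a) * A z, analyticAt_const.add
    ((analyticAt_id.sub analyticAt_const).mul hA), by simp [χ_ne_zero], ?_⟩
  filter_upwards [hs, self_mem_nhdsWithin] with z hz hza
  have h0 : z - a ≠ 0 := sub_ne_zero.2 hza
  rw [hz, zpow_neg_one, smul_eq_mul]; field_simp

lemma meromorphicAt_sm (z : ℂ) : MeromorphicAt sm z := by
  by_cases hz : IsPolePt z
  · obtain ⟨g, hg, -, he⟩ := sm_pole_form hz
    refine MeromorphicAt.congr (f := fun x => (x - z) ^ (-1 : ℤ) • g x) ?_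
      (he.mono fun x hx => hx.symm)
    have := hg.meromorphicAt
    fun_prop
  · exact (analyticAt_sm hz).meromorphicAt

lemma meromorphicOrderAt_sm_of_isPolePt {a : ℂ} (ha : IsPolePt a) :
    meromorphicOrderAt sm a = -1 := by
  have := (meromorphicOrderAt_eq_int_iff (n := -1) (meromorphicAt_sm a)).2 (sm_pole_form ha)
  exact_mod_cast this

lemma mem_poles_sm {z : ℂ} : z ∈ poles sm ↔ IsPolePt z := by
  constructor
  · intro h
    by_contra hz
    exact not_lt.2 (analyticAt_sm hz).meromorphicOrderAt_nonneg h
  · intro h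
    rw [poles, mem_ofPred_eq, meromorphicOrderAt_sm_of_isPolePt h]
    decide

lemma meromorphicNFOn_sm : MeromorphicNFOn sm univ := fun z _ => by
  rw [meromorphicNFAt_iff_analyticAt_or]
  by_cases hz : IsPolePt z
  · exact .inr ⟨meromorphicAt_sm z, mem_poles_sm.2 hz, sm_eq_zero_of_isPolePt hz⟩
  · exact .inl (analyticAt_sm hz)

lemma mem_zeros_sm {z : ℂ} : z ∈ zeros sm ↔ z / K₀ ∈ L.lattice := by
  by_cases hz : IsPolePt z
  · refine ⟨fun h => ?_, fun h => ?_⟩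
    · have h' : 0 < meromorphicOrderAt sm z := h
      exact (lt_asymm h' (mem_poles_sm.2 hz)).elim
    · have h1 : (1 : ℂ) ∈ L.lattice := (add_mem_L_iff h).1 hz
      exact (one_notMem_L h1).elim
  · rw [← sm_eq_zero_iff hz, zeros, mem_ofPred_eq]
    have h0 := (analyticAt_sm hz).meromorphicOrderAt_nonneg
    rw [lt_iff_le_and_ne, and_iff_right h0, ne_comm, Ne,
      (meromorphicNFOn_sm (mem_univ z)).meromorphicOrderAt_eq_zero_iff, not_not]

lemma not_isPolePt_of_mem_zeros {z : ℂ} (hz : z / K₀ ∈ L.lattice) : ¬ IsPolePt z := fun h =>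
  one_notMem_L ((add_mem_L_iff hz).1 h)

lemma meromorphicOrderAt_sm_of_mem_zeros {z : ℂ} (hz : z ∈ zeros sm) :
    meromorphicOrderAt sm z = 1 := by
  have hz' := mem_zeros_sm.1 hz
  have hp := not_isPolePt_of_mem_zeros hz'
  have h0 := (sm_eq_zero_iff hp).2 hz'
  have hc : cm z ≠ 0 := fun h => by simpa [h, h0] using cm_cube_add_sm_cube hp
  have h1 := (analyticAt_sm hp).analyticOrderAt_sub_eq_one_of_deriv_ne_zero
    (by rw [(hasDerivAt_sm hp).deriv]; exact pow_ne_zero 2 hc)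
  simp only [h0, sub_zero] at h1
  rw [(analyticAt_sm hp).meromorphicOrderAt_eq, h1]
  rfl

lemma hasResidue_sm {a : ℂ} (ha : IsPolePt a) : HasResidue sm a (-χ (1 + a / K₀)) := by
  obtain ⟨A, hA, hs⟩ := sm_near_pole ha
  obtain ⟨ε, hε, h⟩ := Metric.eventually_nhds_iff.1
    (hA.eventually_analyticAt.and (eventually_nhdsWithin_iff.1 hs))
  filter_upwards [Ioo_mem_nhdsGT hε] with R hR
  have hAc : ∀ z ∈ closedBall a R, AnalyticAt ℂ A z := fun z hz =>
    (h (lt_of_le_of_lt (mem_closedBall.1 hz) hR.2)).1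
  have hAcont : ContinuousOn A (closedBall a R) := fun z hz =>
    (hAc z hz).continuousAt.continuousWithinAt
  have hne : ∀ z ∈ sphere a R, z - a ≠ 0 := fun z hz h0 => by
    rw [mem_sphere_iff_norm, h0, norm_zero] at hz
    exact hR.1.ne hz
  have e1 : (∮ z in C(a, R), sm z) = ∮ z in C(a, R), (-χ (1 + a / K₀) * (z - a)⁻¹ + A z) :=
    circleIntegral.integral_congr hR.1.le fun z hz =>
      (h (by rw [mem_sphere.1 hz]; exact hR.2)).2 (sub_ne_zero.1 (hne z hz))
  have i1 : CircleIntegrable (fun z => -χ (1 + a / K₀) * (z - a)⁻¹) a R := by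
    refine ContinuousOn.circleIntegrable hR.1.le ?_
    exact continuousOn_const.mul ((continuousOn_id.sub continuousOn_const).inv₀ hne)
  have i2 : CircleIntegrable A a R :=
    (hAcont.mono sphere_subset_closedBall).circleIntegrable hR.1.le
  have e2 : (∮ z in C(a, R), A z) = 0 :=
    Complex.circleIntegral_eq_zero_of_differentiable_on_off_countable hR.1.le countable_empty
      hAcont fun z hz => (hAc z (ball_subset_closedBall hz.1)).differentiableAt
  rw [e1, circleIntegral.integral_add i1 i2, e2, add_zero, circleIntegral.integral_const_mul,
    circleIntegral.integral_sub_inv_of_mem_ball (mem_ball_self hR.1)]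
  have := Complex.two_pi_I_ne_zero
  field_simp

lemma meromorphicOrderAt_cm (z : ℂ) : meromorphicOrderAt cm z = meromorphicOrderAt sm (K₀ - z) :=
  meromorphicOrderAt_comp_of_deriv_ne_zero (f := sm) (g := fun z => (K₀ : ℂ) - z)
    (analyticAt_const.sub analyticAt_id) (by simp)

lemma mem_poles_cm {z : ℂ} : z ∈ poles cm ↔ IsPolePt z := by
  rw [← isPolePt_K₀_sub, ← mem_poles_sm, poles, poles, mem_ofPred_eq, mem_ofPred_eq,
    meromorphicOrderAt_cm]

lemma poles_cm : poles cm = poles sm := by ext z; rw [mem_poles_cm, mem_poles_sm]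

lemma meromorphicNFOn_cm : MeromorphicNFOn cm univ := fun _ _ =>
  (meromorphicNFOn_sm (mem_univ _)).comp_analyticAt (g := fun z => (K₀ : ℂ) - z)
    (analyticAt_const.sub analyticAt_id)

open Classical in
lemma poleMultiplicity_sm (z : ℂ) : poleMultiplicity sm z = if IsPolePt z then 1 else 0 := by
  split_ifs with h
  · rw [poleMultiplicity, meromorphicOrderAt_sm_of_isPolePt h]; rfl
  · have h0 := (analyticAt_sm h).meromorphicOrderAt_nonneg
    rw [poleMultiplicity, Int.toNat_eq_zero, neg_nonpos]
    exact WithTop.untop₀_nonneg.2 h0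

open Classical in
lemma poleMultiplicity_cm (z : ℂ) : poleMultiplicity cm z = if IsPolePt z then 1 else 0 := by
  rw [poleMultiplicity, meromorphicOrderAt_cm, ← poleMultiplicity, poleMultiplicity_sm,
    isPolePt_K₀_sub]

/-! ### Reflections -/

lemma exists_intComb_of_cube_eq_one {ω : ℂ} (h : ω ^ 3 = 1) :
    ∃ p q : ℤ, ω = p * γ + q * γbar ∧ 3 ∣ p + q - 1 ∧ ω = γ ^ (p - q) := by
  rcases cube_eq_one_iff.1 h with rfl | rfl | rfl
  · exact ⟨-1, -1, by push_cast; rw [γbar_eq]; ring, by norm_num, by norm_num⟩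
  · exact ⟨1, 0, by simp, by norm_num, by norm_num⟩
  · refine ⟨0, 1, by simp, by norm_num, ?_⟩
    rw [γ_zpow_eq_of_dvd (n := 2) (by norm_num), ← γ_sq_eq]; norm_cast

lemma sub_mem_L_and_χ {ω ω' : ℂ} (h : ω ^ 3 = 1) (h' : ω' ^ 3 = 1) :
    ω - ω' ∈ L.lattice ∧ χ (ω - ω') = ω * ω'⁻¹ := by
  obtain ⟨p, q, e, hd, eγ⟩ := exists_intComb_of_cube_eq_one h
  obtain ⟨p', q', e', hd', eγ'⟩ := exists_intComb_of_cube_eq_one h'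
  have key : ω - ω' = ((p - p' : ℤ) : ℂ) * γ + ((q - q' : ℤ) : ℂ) * γbar := by
    rw [e, e']; push_cast; ring
  rw [key]
  refine ⟨intComb_mem_L.2 (by omega), ?_⟩
  rw [χ_intComb, eγ, eγ', ← zpow_neg, ← zpow_add₀ γ_ne_zero]
  congr 1; ring

lemma sm_root_mul {ω : ℂ} (h : ω ^ 3 = 1) (z : ℂ) : sm (ω * z) = ω * sm z := by
  rcases cube_eq_one_iff.1 h with rfl | rfl | rfl
  · simp
  · exact sm_γ_mul z
  · exact sm_γbar_mul z

lemma conj_of_cube_eq_one {ω : ℂ} (h : ω ^ 3 = 1) : (starRingEnd ℂ) ω = ω ^ 2 := by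
  rcases cube_eq_one_iff.1 h with rfl | rfl | rfl
  · simp
  · rw [conj_γ, γ_sq_eq]
  · rw [conj_γbar, ← γ_sq_eq]; linear_combination -γ * γ_cube

/-- The reflection in a line through `K₀ ω` and `-K₀ ω'` is conjugation followed by a rotation and a
translation by a multiple of a lattice point. -/
lemma reflect_eq {ω ω' : ℂ} (h : ω ^ 3 = 1) (h' : ω' ^ 3 = 1) (hne : ω ≠ ω') (z : ℂ) :
    reflect (K₀ * ω) (-(K₀ * ω')) z = ω * ω' * (starRingEnd ℂ) z + K₀ * (ω - ω') := by
  have hK := K₀_ne_zero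
  have h0 : ω ≠ 0 := fun h0 => by simp [h0] at h
  have h0' : ω' ≠ 0 := fun h0 => by simp [h0] at h'
  have hq : ω ^ 2 + ω * ω' + ω' ^ 2 = 0 := by
    have : (ω - ω') * (ω ^ 2 + ω * ω' + ω' ^ 2) = 0 := by linear_combination h - h'
    exact (mul_eq_zero.1 this).resolve_left (sub_ne_zero.2 hne)
  have hsum : ω ^ 2 + ω' ^ 2 = -(ω * ω') := by linear_combination hq
  have hsum' : ω + ω' = -(ω * ω') ^ 2 := by
    linear_combination ω ^ 3 * ω' ^ 2 * hq - (ω ^ 2 * ω' ^ 2 + ω * ω' ^ 3 + ω' ^ 4) * h -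
      (ω + ω') * h'
  rw [reflect, map_div₀, map_sub, map_sub, map_neg, map_mul, map_mul, Complex.conj_ofReal,
    conj_of_cube_eq_one h, conj_of_cube_eq_one h',
    show -(K₀ * ω' ^ 2) - K₀ * ω ^ 2 = (K₀ : ℂ) * (ω * ω') by linear_combination -(K₀ : ℂ) * hsum,
    show -(K₀ * ω') - K₀ * ω = (K₀ : ℂ) * (ω * ω') ^ 2 by linear_combination -(K₀ : ℂ) * hsum']
  field_simp
  linear_combination -ω' * (K₀ : ℂ) * h

lemma sm_reflect {ω ω' : ℂ} (h : ω ^ 3 = 1) (h' : ω' ^ 3 = 1) (hne : ω ≠ ω') (z : ℂ) :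
    sm (reflect (K₀ * ω) (-(K₀ * ω')) z) = reflect 0 ω (sm z) := by
  have h0 : ω ≠ 0 := fun h0 => by simp [h0] at h
  have h0' : ω' ≠ 0 := fun h0 => by simp [h0] at h'
  obtain ⟨hL, hχ⟩ := sub_mem_L_and_χ h h'
  rw [reflect_eq h h' hne, sm_add hL, hχ, sm_root_mul (by rw [mul_pow, h, h', mul_one]), sm_conj,
    reflect]
  simp only [sub_zero, zero_add, map_div₀, conj_of_cube_eq_one h]
  field_simp
  linear_combination (starRingEnd ℂ) (sm z) * h

/-! ### Periods -/

lemma mem_periods_sm {w : ℂ} :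
    w ∈ periods sm ↔ ∃ p q : ℤ, w = 3 * K₀ * (p * γ + q * γbar) := by
  constructor
  · intro hw
    have hp : Function.Periodic sm w := hw
    have h0 : sm w = 0 := by simpa [sm_zero] using hp 0
    have h1 : sm (w + K₀) = 1 := by rw [add_comm, hp, sm_K₀]
    by_cases hpole : IsPolePt w
    · -- in this case `w + K₀` would be a zero
      obtain ⟨p, q, hd, rfl⟩ := isPolePt_iff.1 hpole
      have e : K₀ * (p * γ + q * γbar) + K₀ =
          K₀ * (((p - 1 : ℤ) : ℂ) * γ + ((q - 1 : ℤ) : ℂ) * γbar) := by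
        push_cast; rw [γbar_eq]; ring
      have hz : (K₀ * (p * γ + q * γbar) + K₀) / (K₀ : ℂ) ∈ L.lattice :=
        div_K₀_mem_L_iff.2 ⟨_, _, by omega, e⟩
      rw [(sm_eq_zero_iff (not_isPolePt_of_mem_zeros hz)).2 hz] at h1
      exact (zero_ne_one h1).elim
    · have hz := (sm_eq_zero_iff hpole).1 h0
      have hχ := sm_add hz K₀
      rw [mul_div_cancel₀ _ K₀_ne_zero, add_comm, h1, sm_K₀, mul_one] at hχ
      obtain ⟨p, q, hd, e⟩ := mem_L.1 hz
      rw [e, eq_comm, χ_eq_one_iff] at hχ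
      obtain ⟨m, rfl⟩ : (3 : ℤ) ∣ p := by omega
      obtain ⟨n, rfl⟩ : (3 : ℤ) ∣ q := by omega
      refine ⟨m, n, ?_⟩
      rw [div_eq_iff K₀_ne_zero] at e
      rw [e]; push_cast; ring
  · rintro ⟨p, q, rfl⟩ z
    have hl : ((3 * p : ℤ) : ℂ) * γ + ((3 * q : ℤ) : ℂ) * γbar ∈ L.lattice :=
      intComb_mem_L.2 (by omega)
    have := sm_add hl z
    rw [χ_eq_one_iff.2 (by omega), one_mul] at this
    rw [← this]; push_cast; congr 1; ring

lemma periods_cm : periods cm = periods sm := by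
  have hneg : ∀ {w : ℂ}, -w ∈ periods sm → w ∈ periods sm := fun {w} h => by
    have h' : Function.Periodic sm (- -w) := Function.Periodic.neg h
    rwa [neg_neg] at h'
  ext w
  refine ⟨fun h => hneg fun z => ?_, fun h z => ?_⟩
  · have := h (K₀ - z)
    rw [cm, cm, sub_sub_cancel] at this
    rw [← this]; congr 1; ring
  · rw [cm, cm, ← sub_sub]
    exact Function.Periodic.sub_eq h _

lemma periods_sm : periods sm =
    (AddSubgroup.closure {3 * K₀ * γ, 3 * K₀ * γbar} : AddSubgroup ℂ) := by
  ext w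
  rw [mem_periods_sm, SetLike.mem_coe, AddSubgroup.mem_closure_pair]
  refine exists_congr fun p => exists_congr fun q => ?_
  rw [zsmul_eq_mul, zsmul_eq_mul, eq_comm]
  ring_nf

lemma linearIndependent_periods : LinearIndependent ℝ ![3 * K₀ * γ, 3 * K₀ * γbar] := by
  refine LinearIndependent.pair_iff.2 fun a b h => ?_
  have h' : (K₀ * ((3 * a : ℝ) * γ + (3 * b : ℝ) * γbar) : ℂ) =
      K₀ * ((0 : ℝ) * γ + (0 : ℝ) * γbar) := by
    simp only [Complex.real_smul] at h
    push_cast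
    linear_combination h
  obtain ⟨h1, h2⟩ := K₀_comb_inj.1 h'
  constructor <;> linarith

lemma periods_mem : ({3 * (K₀ : ℂ), 3 * K₀ * γ, 3 * K₀ * γbar} : Set ℂ) ⊆ periods sm := by
  rintro w (rfl | rfl | rfl)
  · exact mem_periods_sm.2 ⟨-1, -1, by push_cast; rw [γbar_eq]; ring⟩
  · exact mem_periods_sm.2 ⟨1, 0, by simp⟩
  · exact mem_periods_sm.2 ⟨0, 1, by simp⟩

/-! ### Counting poles in a period cell -/

/-- For each of the three integers `p` with `p γ + q γbar` in the cell, exactly one of the three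
admissible values of `q` gives a pole. -/
lemma finsum_poles_cell {f : ℂ → ℕ} (h1 : ∀ z, IsPolePt z → f z = 1)
    (h0 : ∀ z, ¬ IsPolePt z → f z = 0) (a : ℂ) :
    ∑ᶠ z ∈ cell a (3 * K₀ * γ) (3 * K₀ * γbar), f z = 3 := by
  classical
  obtain ⟨x, y, rfl⟩ := exists_coord a
  set m := ⌈x⌉ with hm
  set n := ⌈y⌉ with hn
  have hm1 := Int.le_ceil x
  have hm2 := Int.ceil_lt_add_one x
  have hn1 := Int.le_ceil y
  have hn2 := Int.ceil_lt_add_one y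
  rw [← hm] at hm1 hm2
  rw [← hn] at hn1 hn2
  let F : ℤ → ℂ := fun i => K₀ * ((m + i : ℤ) * γ + (n + (2 - m - n - i) % 3 : ℤ) * γbar)
  have hF : Function.Injective F := by
    intro i j hij
    have := (intComb_inj.1 (mul_left_cancel₀ K₀_ne_zero hij)).1
    omega
  have hFpole : ∀ i, IsPolePt (F i) := fun i => isPolePt_intComb.2 (by omega)
  have hset : cell (K₀ * (x * γ + y * γbar)) (3 * K₀ * γ) (3 * K₀ * γbar) ∩ Function.support f =
      ((Finset.Ico (0 : ℤ) 3).image F : Finset ℂ) := by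
    ext z
    simp only [mem_inter_iff, Function.mem_support, Finset.coe_image, Finset.coe_Ico, mem_image,
      mem_Ico]
    constructor
    · rintro ⟨⟨t, ht, u, hu, rfl⟩, hz⟩
      have hp := not_imp_comm.1 (h0 _) hz
      obtain ⟨p, q, hd, e⟩ := isPolePt_iff.1 hp
      have e' : (K₀ * ((x + 3 * t : ℝ) * γ + (y + 3 * u : ℝ) * γbar) : ℂ) =
          K₀ * ((p : ℝ) * γ + (q : ℝ) * γbar) := by
        push_cast; linear_combination e
      obtain ⟨e1, e2⟩ := K₀_comb_inj.1 e'
      have a1 : m ≤ p := Int.ceil_le.2 (by linarith [ht.1])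
      have a2 : p < m + 3 := by
        have : (p : ℝ) < m + 3 := by linarith [ht.2]
        exact_mod_cast this
      have b1 : n ≤ q := Int.ceil_le.2 (by linarith [hu.1])
      have b2 : q < n + 3 := by
        have : (q : ℝ) < n + 3 := by linarith [hu.2]
        exact_mod_cast this
      refine ⟨p - m, by omega, ?_⟩
      rw [e]
      have c1 : m + (p - m) = p := by omega
      have c2 : n + (2 - m - n - (p - m)) % 3 = q := by omega
      simp only [F, c1, c2]
    · rintro ⟨i, hi, rfl⟩
      refine ⟨?_, by rw [h1 _ (hFpole i)]; exact one_ne_zero⟩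
      set j := (2 - m - n - i) % 3 with hj
      have hi0 : (0 : ℝ) ≤ i := by exact_mod_cast hi.1
      have hi2 : (i : ℝ) ≤ 2 := by exact_mod_cast (by omega : i ≤ 2)
      have hj0 : (0 : ℝ) ≤ j := by exact_mod_cast (by omega : 0 ≤ j)
      have hj2 : (j : ℝ) ≤ 2 := by exact_mod_cast (by omega : j ≤ 2)
      refine ⟨(m + i - x) / 3, ⟨by linarith, by linarith⟩, (n + j - y) / 3,
        ⟨by linarith, by linarith⟩, ?_⟩
      simp only [F, ← hj]
      push_cast; ring
  rw [← finsum_mem_inter_support, hset, finsum_mem_coe_finset,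
    Finset.sum_image fun i _ j _ h => hF h, Finset.sum_congr rfl fun i _ => h1 _ (hFpole i)]
  simp

/-! ### The fundamental parallelogram -/

lemma coordX_K₀_comb (x y : ℝ) : coordX (K₀ * (x * γ + y * γbar)) = K₀ * x := by
  rw [mul_add, ← mul_assoc, ← mul_assoc, ← Complex.ofReal_mul, ← Complex.ofReal_mul, coordX_comb]

lemma coordY_K₀_comb (x y : ℝ) : coordY (K₀ * (x * γ + y * γbar)) = K₀ * y := by
  rw [mul_add, ← mul_assoc, ← mul_assoc, ← Complex.ofReal_mul, ← Complex.ofReal_mul, coordY_comb]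

lemma comb_mem_P {x y : ℝ} :
    (K₀ * (x * γ + y * γbar) : ℂ) ∈ P K₀ ↔ x ∈ Icc (0 : ℝ) 3 ∧ y ∈ Icc (0 : ℝ) 3 := by
  have hK := K₀_pos
  have e0 : (0 : ℂ) = K₀ * ((0 : ℝ) * γ + (0 : ℝ) * γbar) := by simp
  have e1 : -3 * (K₀ : ℂ) = K₀ * ((3 : ℝ) * γ + (3 : ℝ) * γbar) := by
    push_cast; rw [γbar_eq]; ring
  have e2 : 3 * (K₀ : ℂ) * γ = K₀ * ((3 : ℝ) * γ + (0 : ℝ) * γbar) := by push_cast; ring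
  have e3 : 3 * (K₀ : ℂ) * γbar = K₀ * ((0 : ℝ) * γ + (3 : ℝ) * γbar) := by push_cast; ring
  constructor
  · intro h
    have hX : IsLinearMap ℝ coordX := ⟨fun z w => by simp [coordX]; ring,
      fun t z => by simp [coordX]; ring⟩
    have hY : IsLinearMap ℝ coordY := ⟨fun z w => by simp [coordY]; ring,
      fun t z => by simp [coordY]; ring⟩
    have hconv : Convex ℝ (coordX ⁻¹' Icc 0 (3 * K₀) ∩ coordY ⁻¹' Icc 0 (3 * K₀)) :=
      ((convex_Icc _ _).is_linear_preimage hX).inter ((convex_Icc _ _).is_linear_preimage hY)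
    have hsub : P K₀ ⊆ coordX ⁻¹' Icc 0 (3 * K₀) ∩ coordY ⁻¹' Icc 0 (3 * K₀) := by
      refine convexHull_min ?_ hconv
      rintro z (rfl | rfl | rfl | rfl)
      · rw [e0]; simp only [mem_inter_iff, mem_preimage, coordX_K₀_comb, coordY_K₀_comb, mem_Icc]
        constructor <;> constructor <;> linarith
      · rw [e1]; simp only [mem_inter_iff, mem_preimage, coordX_K₀_comb, coordY_K₀_comb, mem_Icc]
        constructor <;> constructor <;> linarith
      · rw [e2]; simp only [mem_inter_iff, mem_preimage, coordX_K₀_comb, coordY_K₀_comb, mem_Icc]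
        constructor <;> constructor <;> linarith
      · rw [e3]; simp only [mem_inter_iff, mem_preimage, coordX_K₀_comb, coordY_K₀_comb, mem_Icc]
        constructor <;> constructor <;> linarith
    obtain ⟨hx, hy⟩ := hsub h
    simp only [mem_preimage, coordX_K₀_comb, coordY_K₀_comb, mem_Icc] at hx hy
    refine ⟨⟨?_, ?_⟩, ⟨?_, ?_⟩⟩ <;> nlinarith
  · rintro ⟨hx, hy⟩
    have hc : Convex ℝ (P K₀) := convex_convexHull ℝ _
    have hsub := subset_convexHull ℝ ({0, -3 * (K₀ : ℂ), 3 * K₀ * γ, 3 * K₀ * γbar} : Set ℂ)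
    have m0 : (0 : ℂ) ∈ P K₀ := hsub (by simp)
    have m1 : -3 * (K₀ : ℂ) ∈ P K₀ := hsub (by simp)
    have m2 : 3 * (K₀ : ℂ) * γ ∈ P K₀ := hsub (by simp)
    have m3 : 3 * (K₀ : ℂ) * γbar ∈ P K₀ := hsub (by simp)
    have hx0 : 0 ≤ x / 3 := by linarith [hx.1]
    have hx1 : 0 ≤ 1 - x / 3 := by linarith [hx.2]
    have hy0 : 0 ≤ y / 3 := by linarith [hy.1]
    have hy1 : 0 ≤ 1 - y / 3 := by linarith [hy.2]
    have n1 := hc m0 m2 hx1 hx0 (by ring)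
    have n2 := hc m3 m1 hx1 hx0 (by ring)
    have n3 := hc n1 n2 hy1 hy0 (by ring)
    convert n3 using 1
    simp only [Complex.real_smul]
    push_cast; rw [γbar_eq]; ring

lemma comb_mem_interior_P {x y : ℝ} (h : (K₀ * (x * γ + y * γbar) : ℂ) ∈ interior (P K₀)) :
    x ∈ Ioo (0 : ℝ) 3 ∧ y ∈ Ioo (0 : ℝ) 3 := by
  have hcont : ContinuousAt (fun δ : ℝ => (K₀ * ((x + δ : ℝ) * γ + (y + δ : ℝ) * γbar) : ℂ)) 0 := by
    fun_prop
  have hev := hcont.eventually_mem (s := P K₀) (by simpa using mem_interior_iff_mem_nhds.1 h)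
  obtain ⟨ε, hε, hev⟩ := Metric.eventually_nhds_iff.1 hev
  have h1 := comb_mem_P.1 (hev (y := ε / 2) (by simp [abs_of_pos hε]; linarith))
  have h2 := comb_mem_P.1 (hev (y := -(ε / 2)) (by simp [abs_of_pos hε]; linarith))
  simp only [mem_Icc] at h1 h2
  exact ⟨⟨by linarith [h2.1.1], by linarith [h1.1.2]⟩, ⟨by linarith [h2.2.1], by linarith [h1.2.2]⟩⟩

lemma isFundamentalDomain_P : IsFundamentalDomain (P K₀) (periods sm) := by
  refine ⟨((Set.toFinite _).isCompact_convexHull ℝ).isClosed, fun z => ?_, fun z hz y hy hyz => ?_⟩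
  · obtain ⟨x, y, rfl⟩ := exists_coord z
    refine ⟨_, mem_periods_sm.2 ⟨-⌊x / 3⌋, -⌊y / 3⌋, rfl⟩, ?_⟩
    have e : (K₀ * (x * γ + y * γbar) +
        3 * K₀ * (((-⌊x / 3⌋ : ℤ) : ℂ) * γ + ((-⌊y / 3⌋ : ℤ) : ℂ) * γbar) : ℂ) =
        K₀ * ((x - 3 * ⌊x / 3⌋ : ℝ) * γ + (y - 3 * ⌊y / 3⌋ : ℝ) * γbar) := by
      push_cast; ring
    rw [e, comb_mem_P]
    have := Int.floor_le (x / 3)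
    have := Int.lt_floor_add_one (x / 3)
    have := Int.floor_le (y / 3)
    have := Int.lt_floor_add_one (y / 3)
    exact ⟨⟨by linarith, by linarith⟩, ⟨by linarith, by linarith⟩⟩
  · obtain ⟨a, b, rfl⟩ := exists_coord z
    obtain ⟨a', b', rfl⟩ := exists_coord y
    obtain ⟨ha, hb⟩ := comb_mem_interior_P hz
    obtain ⟨ha', hb'⟩ := comb_mem_P.1 hy
    obtain ⟨p, q, e⟩ := mem_periods_sm.1 hyz
    have e' : (K₀ * (a' * γ + b' * γbar) : ℂ) =
        K₀ * ((a + 3 * p : ℝ) * γ + (b + 3 * q : ℝ) * γbar) := by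
      push_cast; linear_combination e
    obtain ⟨e1, e2⟩ := K₀_comb_inj.1 e'
    have small : ∀ {s s' : ℝ} {n : ℤ}, s ∈ Ioo (0 : ℝ) 3 → s' ∈ Icc (0 : ℝ) 3 →
        s' = s + 3 * n → n = 0 := by
      intro s s' n hs hs' h
      have h1 : (n : ℝ) < 1 := by linarith [hs.1, hs'.2]
      have h2 : (-1 : ℝ) < n := by linarith [hs.2, hs'.1]
      have h1' : n < 1 := by exact_mod_cast h1
      have h2' : -1 < n := by exact_mod_cast h2
      omega
    rw [e1, e2, small ha ha' e1, small hb hb' e2]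
    simp

lemma intComb_mem_P {p q : ℤ} : (K₀ * (p * γ + q * γbar) : ℂ) ∈ P K₀ ↔
    (0 ≤ p ∧ p ≤ 3) ∧ 0 ≤ q ∧ q ≤ 3 := by
  have := comb_mem_P (x := p) (y := q)
  simp only [Complex.ofReal_intCast, mem_Icc] at this
  rw [this]
  norm_cast

lemma intComb_mem_shiftedP {ε : ℝ} (hε : ε ∈ Ioo 0 K₀) {p q : ℤ} :
    (K₀ * (p * γ + q * γbar) : ℂ) ∈ shiftedP K₀ ε ↔ (0 ≤ p ∧ p ≤ 2) ∧ 0 ≤ q ∧ q ≤ 2 := by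
  have hK := K₀_pos
  have hδ0 : 0 < ε / K₀ := div_pos hε.1 hK
  have hδ1 : ε / K₀ < 1 := (div_lt_one hK).2 hε.2
  have h1 : (K₀ * (p * γ + q * γbar) : ℂ) ∈ shiftedP K₀ ε ↔
      (K₀ * ((p + ε / K₀ : ℝ) * γ + (q + ε / K₀ : ℝ) * γbar) : ℂ) ∈ P K₀ := by
    have e : (K₀ * ((p + ε / K₀ : ℝ) * γ + (q + ε / K₀ : ℝ) * γbar) : ℂ) =
        K₀ * (p * γ + q * γbar) - ε := by
      have := K₀_ne_zero
      push_cast; rw [γbar_eq]; field_simp; ring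
    rw [e, shiftedP]
    constructor
    · rintro ⟨z, hz, h⟩
      rw [← h]; simpa using hz
    · intro h
      exact ⟨_, h, by simp⟩
  rw [h1, comb_mem_P]
  have key : ∀ n : ℤ, ((n : ℝ) + ε / K₀ ∈ Icc (0 : ℝ) 3 ↔ 0 ≤ n ∧ n ≤ 2) := by
    intro n
    constructor
    · rintro ⟨ha, hb⟩
      have h1 : (-1 : ℝ) < n := by linarith
      have h2 : (n : ℝ) < 3 := by linarith
      have h1' : -1 < n := by exact_mod_cast h1
      have h2' : n < 3 := by exact_mod_cast h2
      omega
    · rintro ⟨ha, hb⟩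
      have h1 : (0 : ℝ) ≤ n := by exact_mod_cast ha
      have h2 : (n : ℝ) ≤ 2 := by exact_mod_cast hb
      exact ⟨by linarith, by linarith⟩
  rw [key, key]

lemma P_inter_poles : P K₀ ∩ poles sm =
    {-(K₀ : ℂ), 2 * K₀ * γ, 2 * K₀ * γbar, K₀ * γ - 2 * K₀, K₀ * γbar - 2 * K₀} := by
  have e1 : -(K₀ : ℂ) = K₀ * ((1 : ℤ) * γ + (1 : ℤ) * γbar) := by push_cast; rw [γbar_eq]; ring
  have e2 : 2 * (K₀ : ℂ) * γ = K₀ * ((2 : ℤ) * γ + (0 : ℤ) * γbar) := by push_cast; ring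
  have e3 : 2 * (K₀ : ℂ) * γbar = K₀ * ((0 : ℤ) * γ + (2 : ℤ) * γbar) := by push_cast; ring
  have e4 : (K₀ : ℂ) * γ - 2 * K₀ = K₀ * ((3 : ℤ) * γ + (2 : ℤ) * γbar) := by
    push_cast; rw [γbar_eq]; ring
  have e5 : (K₀ : ℂ) * γbar - 2 * K₀ = K₀ * ((2 : ℤ) * γ + (3 : ℤ) * γbar) := by
    push_cast; rw [γbar_eq]; ring
  rw [e1, e2, e3, e4, e5]
  ext z
  simp only [mem_inter_iff, mem_insert_iff, mem_singleton_iff, mem_poles_sm]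
  constructor
  · rintro ⟨hP, hz⟩
    obtain ⟨p, q, hd, rfl⟩ := isPolePt_iff.1 hz
    rw [intComb_mem_P] at hP
    simp only [mul_right_inj' K₀_ne_zero, intComb_inj]
    omega
  · rintro (rfl | rfl | rfl | rfl | rfl) <;> rw [intComb_mem_P, isPolePt_intComb] <;> norm_num

lemma shiftedP_inter_poles {ε : ℝ} (hε : ε ∈ Ioo 0 K₀) : shiftedP K₀ ε ∩ poles sm =
    {-(K₀ : ℂ), 2 * K₀ * γ, 2 * K₀ * γbar} := by
  have e1 : -(K₀ : ℂ) = K₀ * ((1 : ℤ) * γ + (1 : ℤ) * γbar) := by push_cast; rw [γbar_eq]; ring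
  have e2 : 2 * (K₀ : ℂ) * γ = K₀ * ((2 : ℤ) * γ + (0 : ℤ) * γbar) := by push_cast; ring
  have e3 : 2 * (K₀ : ℂ) * γbar = K₀ * ((0 : ℤ) * γ + (2 : ℤ) * γbar) := by push_cast; ring
  rw [e1, e2, e3]
  ext z
  simp only [mem_inter_iff, mem_insert_iff, mem_singleton_iff, mem_poles_sm]
  constructor
  · rintro ⟨hP, hz⟩
    obtain ⟨p, q, hd, rfl⟩ := isPolePt_iff.1 hz
    rw [intComb_mem_shiftedP hε] at hP
    simp only [mul_right_inj' K₀_ne_zero, intComb_inj]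
    omega
  · rintro (rfl | rfl | rfl) <;> rw [intComb_mem_shiftedP hε, isPolePt_intComb] <;> norm_num

lemma shiftedP_inter_zeros {ε : ℝ} (hε : ε ∈ Ioo 0 K₀) : shiftedP K₀ ε ∩ zeros sm =
    {0, -K₀ + K₀ * γ, -K₀ + K₀ * γbar} := by
  have e1 : (0 : ℂ) = K₀ * ((0 : ℤ) * γ + (0 : ℤ) * γbar) := by simp
  have e2 : -(K₀ : ℂ) + K₀ * γ = K₀ * ((2 : ℤ) * γ + (1 : ℤ) * γbar) := by
    push_cast; rw [γbar_eq]; ring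
  have e3 : -(K₀ : ℂ) + K₀ * γbar = K₀ * ((1 : ℤ) * γ + (2 : ℤ) * γbar) := by
    push_cast; rw [γbar_eq]; ring
  rw [e1, e2, e3]
  ext z
  simp only [mem_inter_iff, mem_insert_iff, mem_singleton_iff, mem_zeros_sm]
  constructor
  · rintro ⟨hP, hz⟩
    obtain ⟨p, q, hd, rfl⟩ := div_K₀_mem_L_iff.1 hz
    rw [intComb_mem_shiftedP hε] at hP
    simp only [mul_right_inj' K₀_ne_zero, intComb_inj]
    omega
  · rintro (rfl | rfl | rfl) <;>
      rw [intComb_mem_shiftedP hε, mul_div_cancel_left₀ _ K₀_ne_zero, intComb_mem_L] <;> norm_num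

lemma exists_sm_eq_of_mem_segment {ω a : ℂ} (hω : ω ^ 3 = 1) (ha : a ∈ periods sm) {b : ℂ}
    (hb : ∃ x : ℝ, b = a + ω * x) {z : ℂ} (hz : z ∈ segment ℝ a b) : ∃ t : ℝ, sm z = ω * t := by
  obtain ⟨x, rfl⟩ := hb
  rw [segment_eq_image] at hz
  obtain ⟨θ, -, rfl⟩ := hz
  refine ⟨(sm (θ * x : ℝ)).re, ?_⟩
  have hp : Function.Periodic sm a := ha
  rw [← sm_ofReal, ← sm_root_mul hω, ← hp (ω * (θ * x : ℝ))]
  congr 1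
  simp only [Complex.real_smul]; push_cast; ring

/-! ### Real values and bounds for `K₀` -/

lemma not_isPolePt_ofReal {x : ℝ} (hx : x ∈ Ioo (-K₀) (2 * K₀)) : ¬ IsPolePt x := by
  have hK := K₀_pos
  have e : 1 + (x : ℂ) / K₀ = ((1 + x / K₀ : ℝ) : ℂ) := by push_cast; ring
  have h1 : -1 < x / K₀ := by rw [lt_div_iff₀ hK]; linarith [hx.1]
  have h2 : x / K₀ < 2 := by rw [div_lt_iff₀ hK]; linarith [hx.2]
  rw [IsPolePt, e]
  exact ofReal_notMem_L (by linarith) (by linarith)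

lemma hasDerivAt_sm_re {x : ℝ} (hx : x ∈ Ioo (-K₀) (2 * K₀)) :
    HasDerivAt (fun y : ℝ => (sm y).re) ((cm x).re ^ 2) x := by
  have h := (hasDerivAt_sm (not_isPolePt_ofReal hx)).real_of_complex
  rw [cm_ofReal] at h
  convert h using 1
  norm_cast

lemma re_cube_add {x : ℝ} (hx : x ∈ Ioo (-K₀) (2 * K₀)) :
    (cm x).re ^ 3 + (sm x).re ^ 3 = 1 := by
  have h := cm_cube_add_sm_cube (not_isPolePt_ofReal hx)
  rw [cm_ofReal, sm_ofReal] at h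
  exact_mod_cast h

/-- The derivative of `sm` vanishes on the real axis only at `K₀ + 3 K₀ ℤ`. -/
lemma cm_re_ne_zero {x : ℝ} (hx : x ∈ Ioo (-K₀) K₀) : (cm x).re ≠ 0 := by
  have hK := K₀_pos
  intro h
  have hp : ¬ IsPolePt ((K₀ : ℂ) - x) := by
    rw [isPolePt_K₀_sub]
    exact not_isPolePt_ofReal ⟨hx.1, by linarith [hx.2]⟩
  have h0 : sm ((K₀ : ℂ) - x) = 0 := by
    have := cm_ofReal x
    rwa [h, Complex.ofReal_zero] at this
  have hL := (sm_eq_zero_iff hp).1 h0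
  have e : ((K₀ : ℂ) - x) / K₀ = ((1 - x / K₀ : ℝ) : ℂ) := by
    have := K₀_ne_zero
    push_cast; field_simp
  have h1 : -1 < x / K₀ := by rw [lt_div_iff₀ hK]; linarith [hx.1]
  have h2 : x / K₀ < 1 := by rw [div_lt_iff₀ hK]; linarith [hx.2]
  rw [e] at hL
  exact ofReal_notMem_L (by linarith) (by linarith) hL

lemma strictMonoOn_sm_re : StrictMonoOn (fun y : ℝ => (sm y).re) (Ioo (-K₀) K₀) := by
  have hK := K₀_pos
  have hsub : ∀ {x}, x ∈ Ioo (-K₀) K₀ → x ∈ Ioo (-K₀) (2 * K₀) := fun h =>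
    ⟨h.1, by linarith [h.2]⟩
  refine strictMonoOn_of_deriv_pos (convex_Ioo _ _)
    (fun x hx => (hasDerivAt_sm_re (hsub hx)).continuousAt.continuousWithinAt) fun x hx => ?_
  rw [interior_Ioo] at hx
  rw [(hasDerivAt_sm_re (hsub hx)).deriv]
  have := cm_re_ne_zero hx
  positivity

lemma monotoneOn_sm_re : MonotoneOn (fun y : ℝ => (sm y).re) (Ioo (-K₀) (2 * K₀)) := by
  refine monotoneOn_of_deriv_nonneg (convex_Ioo _ _)
    (fun x hx => (hasDerivAt_sm_re hx).continuousAt.continuousWithinAt)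
    (fun x hx => (hasDerivAt_sm_re (interior_subset hx)).differentiableAt.differentiableWithinAt)
    fun x hx => ?_
  rw [(hasDerivAt_sm_re (interior_subset hx)).deriv]
  positivity

lemma sm_neg_half : sm (-(K₀ / 2)) = -1 := by
  have hK := K₀_pos
  have hmem : -(K₀ / 2) ∈ Ioo (-K₀) K₀ := ⟨by linarith, by linarith⟩
  have e : (-(K₀ / 2) : ℂ) = ((-(K₀ / 2) : ℝ) : ℂ) := by push_cast; ring
  have hneg : (sm (-(K₀ / 2) : ℝ)).re < 0 := by
    have := strictMonoOn_sm_re hmem (mem_Ioo.2 ⟨by linarith, hK⟩ : (0 : ℝ) ∈ _) (by linarith)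
    simpa only [Complex.ofReal_zero, sm_zero, Complex.zero_re] using this
  have hp := not_isPolePt_ofReal (x := -(K₀ / 2)) ⟨hmem.1, by linarith⟩
  have hz : ((-(K₀ / 2) : ℝ) : ℂ) / K₀ ∉ L.lattice := fun h => by
    rw [← sm_eq_zero_iff hp] at h
    rw [h, Complex.zero_re] at hneg
    exact lt_irrefl _ hneg
  have hmul := sm_mul_sm hp hz
  have h3 := sm_add three_mem_L ((-(K₀ / 2) : ℝ) : ℂ)
  rw [χ_three, one_mul] at h3
  rw [show 2 * (K₀ : ℂ) - ((-(K₀ / 2) : ℝ) : ℂ) = ((-(K₀ / 2) : ℝ) : ℂ) + K₀ * 3 by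
    push_cast; ring, h3, sm_ofReal] at hmul
  have hsq : (sm (-(K₀ / 2) : ℝ)).re * (sm (-(K₀ / 2) : ℝ)).re = 1 := by exact_mod_cast hmul
  have : (sm (-(K₀ / 2) : ℝ)).re = -1 := by nlinarith
  rw [e, sm_ofReal, this]; simp

/-- On `(-K₀/2, 0)` the slope `cm² = (1 - sm³)^(2/3)` exceeds `1`, while `sm` grows by `1`. -/
lemma K₀_lt_two : K₀ < 2 := by
  have hK := K₀_pos
  have hsub : ∀ {x}, x ∈ Icc (-(K₀ / 2)) 0 → x ∈ Ioo (-K₀) (2 * K₀) := fun h =>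
    ⟨by linarith [h.1], by linarith [h.2]⟩
  obtain ⟨ξ, hξ, h⟩ := exists_hasDerivAt_eq_slope (fun y : ℝ => (sm y).re)
    (fun x => (cm x).re ^ 2) (a := -(K₀ / 2)) (b := 0) (by linarith)
    (fun x hx => (hasDerivAt_sm_re (hsub hx)).continuousAt.continuousWithinAt)
    (fun x hx => hasDerivAt_sm_re (hsub (Ioo_subset_Icc_self hx)))
  have e : sm ((-(K₀ / 2) : ℝ) : ℂ) = -1 := by
    rw [← sm_neg_half]; push_cast; rfl
  simp only [e, Complex.ofReal_zero, sm_zero, Complex.zero_re, Complex.neg_re, Complex.one_re] at h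
  have hneg : (sm ξ).re < 0 := by
    have := strictMonoOn_sm_re (⟨by linarith [hξ.1], by linarith [hξ.2]⟩ : ξ ∈ Ioo (-K₀) K₀)
      (mem_Ioo.2 ⟨by linarith, hK⟩ : (0 : ℝ) ∈ _) hξ.2
    simpa only [Complex.ofReal_zero, sm_zero, Complex.zero_re] using this
  have hc := re_cube_add (hsub (Ioo_subset_Icc_self hξ))
  have hs3 : (sm ξ).re ^ 3 < 0 := Odd.pow_neg (by decide) hneg
  have hc1 : 1 < (cm ξ).re := by
    by_contra! hle
    nlinarith [sq_nonneg ((cm ξ).re + 1), sq_nonneg (cm ξ).re]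
  have h2 : 1 < (0 - -1) / (0 - -(K₀ / 2)) := by rw [← h]; nlinarith
  rw [lt_div_iff₀ (by linarith)] at h2
  linarith

/-- On `(0, K₀)` the slope `cm²` is at most `1`, while `sm` grows by `1`. -/
lemma one_le_K₀ : 1 ≤ K₀ := by
  have hK := K₀_pos
  have hsub : ∀ {x}, x ∈ Icc 0 K₀ → x ∈ Ioo (-K₀) (2 * K₀) := fun h =>
    ⟨by linarith [h.1], by linarith [h.2]⟩
  obtain ⟨ξ, hξ, h⟩ := exists_hasDerivAt_eq_slope (fun y : ℝ => (sm y).re)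
    (fun x => (cm x).re ^ 2) (a := 0) (b := K₀) hK
    (fun x hx => (hasDerivAt_sm_re (hsub hx)).continuousAt.continuousWithinAt)
    (fun x hx => hasDerivAt_sm_re (hsub (Ioo_subset_Icc_self hx)))
  have hξ' := hsub (Ioo_subset_Icc_self hξ)
  have h0 : 0 ≤ (sm ξ).re := by
    have := monotoneOn_sm_re (hsub (left_mem_Icc.2 hK.le)) hξ' hξ.1.le
    simpa only [Complex.ofReal_zero, sm_zero, Complex.zero_re] using this
  have h1 : (sm ξ).re ≤ 1 := by
    have := monotoneOn_sm_re hξ' (hsub (right_mem_Icc.2 hK.le)) hξ.2.le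
    simpa only [sm_K₀, Complex.one_re] using this
  simp only [sm_K₀, Complex.ofReal_zero, sm_zero, Complex.zero_re, Complex.one_re, sub_zero] at h
  have hc := re_cube_add hξ'
  have hs3 : 0 ≤ (sm ξ).re ^ 3 := pow_nonneg h0 3
  have hs3' : (sm ξ).re ^ 3 ≤ 1 := pow_le_one₀ h0 h1
  have hc0 : 0 ≤ (cm ξ).re := by
    by_contra! hlt
    have : (cm ξ).re ^ 3 < 0 := Odd.pow_neg (by decide) hlt
    linarith
  have hc1 : (cm ξ).re ≤ 1 := by
    by_contra! hlt
    have : 1 < (cm ξ).re ^ 3 := one_lt_pow₀ hlt (by norm_num)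
    linarith
  have h2 : 1 / K₀ ≤ 1 := by rw [← h]; exact pow_le_one₀ hc0 hc1
  rwa [div_le_iff₀ hK, one_mul] at h2

lemma eq_K₀_of_sm_eq {x : ℝ} (hx : x ∈ Ioo (0 : ℝ) 2) (h : sm (-(x / 2)) = -1) : x = K₀ := by
  have hK := one_le_K₀
  have e1 : sm ((-(x / 2) : ℝ) : ℂ) = -1 := by rw [← h]; push_cast; rfl
  have e2 : sm ((-(K₀ / 2) : ℝ) : ℂ) = -1 := by rw [← sm_neg_half]; push_cast; rfl
  have := strictMonoOn_sm_re.injOn (x₁ := -(x / 2)) (x₂ := -(K₀ / 2))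
    ⟨by linarith [hx.2], by linarith [hx.1]⟩ ⟨by linarith, by linarith⟩
    (by simp only [e1, e2])
  linarith

/-! ### The initial value problem -/

lemma r_lt_one : r < 1 := Real.rpow_lt_one_of_one_lt_of_neg (by norm_num) (by norm_num)

lemma not_isPolePt_of_mem_ball {z : ℂ} (hz : z ∈ ball (0 : ℂ) r) : ¬ IsPolePt z := by
  intro h
  obtain ⟨p, q, hd, rfl⟩ := isPolePt_iff.1 h
  rw [mem_ball_zero_iff, norm_mul, Complex.norm_real, Real.norm_of_nonneg K₀_pos.le] at hz
  have h1 := one_le_norm_intComb (p := p) (q := q) (by omega)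
  have := one_le_K₀
  have := r_lt_one
  nlinarith

lemma solvesIVP : SolvesIVP cm sm (poles sm)ᶜ :=
  ⟨cm_zero, sm_zero, fun _ hz =>
    ⟨hasDerivAt_cm (mt mem_poles_sm.2 hz), hasDerivAt_sm (mt mem_poles_sm.2 hz)⟩⟩

lemma SolvesIVP.mono {c s : ℂ → ℂ} {U V : Set ℂ} (h : SolvesIVP c s U) (hV : V ⊆ U) :
    SolvesIVP c s V := ⟨h.1, h.2.1, fun z hz => h.2.2 z (hV hz)⟩

lemma dist_sq_le {a b : ℂ} {R : ℝ} (ha : ‖a‖ ≤ R) (hb : ‖b‖ ≤ R) :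
    dist (a ^ 2) (b ^ 2) ≤ 2 * R * dist a b := by
  rw [dist_eq_norm, dist_eq_norm, sq_sub_sq, norm_mul]
  gcongr
  linarith [norm_add_le a b]

/-- Two solutions on a disc about the origin agree: along each ray they solve the same ordinary
differential equation, which is locally Lipschitz. -/
theorem SolvesIVP.unique {c s c' s' : ℂ → ℂ} {ρ : ℝ} (h : SolvesIVP c s (ball 0 ρ))
    (h' : SolvesIVP c' s' (ball 0 ρ)) {z : ℂ} (hz : z ∈ ball (0 : ℂ) ρ) :
    c z = c' z ∧ s z = s' z := by
  have hmem : ∀ t ∈ Icc (0 : ℝ) 1, (t : ℂ) * z ∈ ball (0 : ℂ) ρ := by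
    intro t ht
    rw [mem_ball_zero_iff] at hz ⊢
    rw [norm_mul, Complex.norm_real, Real.norm_of_nonneg ht.1]
    nlinarith [ht.2, norm_nonneg z]
  let v : ℝ → ℂ × ℂ → ℂ × ℂ := fun _ y => (z * -y.2 ^ 2, z * y.1 ^ 2)
  have key : ∀ {c s : ℂ → ℂ}, SolvesIVP c s (ball 0 ρ) → ∀ t ∈ Icc (0 : ℝ) 1,
      HasDerivAt (fun t : ℝ => (c (t * z), s (t * z))) (v t (c (t * z), s (t * z))) t := by
    intro c s h t ht
    have hg : HasDerivAt (fun t : ℝ => (t : ℂ) * z) z t := by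
      simpa using (Complex.ofRealCLM.hasDerivAt (x := t)).mul_const z
    obtain ⟨h1, h2⟩ := h.2.2 _ (hmem t ht)
    exact (h1.scomp t hg).prodMk (h2.scomp t hg)
  have hcont : ∀ {c s : ℂ → ℂ}, SolvesIVP c s (ball 0 ρ) →
      ContinuousOn (fun t : ℝ => (c (t * z), s (t * z))) (Icc 0 1) := fun h t ht =>
    (key h t ht).continuousAt.continuousWithinAt
  obtain ⟨R₁, hR₁⟩ := isCompact_Icc.exists_bound_of_continuousOn (hcont h)
  obtain ⟨R₂, hR₂⟩ := isCompact_Icc.exists_bound_of_continuousOn (hcont h')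
  set R := max (max R₁ R₂) 0 with hR
  have hlip : LipschitzOnWith (‖z‖ * (2 * R)).toNNReal (v 0) (closedBall 0 R) := by
    refine LipschitzOnWith.of_dist_le_mul fun a ha b hb => ?_
    rw [mem_closedBall_zero_iff] at ha hb
    have hR0 : 0 ≤ R := le_max_right _ _
    rw [Real.coe_toNNReal _ (by positivity), Prod.dist_eq]
    have h1 := dist_sq_le ((norm_fst_le a).trans ha) ((norm_fst_le b).trans hb)
    have h2 := dist_sq_le ((norm_snd_le a).trans ha) ((norm_snd_le b).trans hb)
    have g1 : dist a.1 b.1 ≤ dist a b := le_max_left _ _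
    have g2 : dist a.2 b.2 ≤ dist a b := le_max_right _ _
    have hm : ∀ x y : ℂ, dist (z * x) (z * y) = ‖z‖ * dist x y := fun x y => by
      rw [dist_eq_norm, dist_eq_norm, ← mul_sub, norm_mul]
    simp only [v, hm, dist_neg_neg]
    refine max_le ?_ ?_
    · calc ‖z‖ * dist (a.2 ^ 2) (b.2 ^ 2) ≤ ‖z‖ * (2 * R * dist a b) := by
            gcongr; exact h2.trans (by gcongr)
        _ = _ := by ring
    · calc ‖z‖ * dist (a.1 ^ 2) (b.1 ^ 2) ≤ ‖z‖ * (2 * R * dist a b) := by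
            gcongr; exact h1.trans (by gcongr)
        _ = _ := by ring
  have huniq := ODE_solution_unique_of_mem_Icc_right (v := v) (s := fun _ => closedBall 0 R)
    (K := (‖z‖ * (2 * R)).toNNReal) (a := 0) (b := 1) (fun _ _ => hlip) (hcont h)
    (fun t ht => (key h t (Ico_subset_Icc_self ht)).hasDerivWithinAt)
    (fun t ht => mem_closedBall_zero_iff.2 ((hR₁ t (Ico_subset_Icc_self ht)).trans
      ((le_max_left _ _).trans (le_max_left _ _))))
    (hcont h') (fun t ht => (key h' t (Ico_subset_Icc_self ht)).hasDerivWithinAt)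
    (fun t ht => mem_closedBall_zero_iff.2 ((hR₂ t (Ico_subset_Icc_self ht)).trans
      ((le_max_right _ _).trans (le_max_left _ _))))
    (by simp [h.1, h.2.1, h'.1, h'.2.1])
  simpa using huniq (right_mem_Icc.2 zero_le_one)

lemma isElliptic_of {f : ℂ → ℂ} (hf : MeromorphicNFOn f univ) (hp : periods f = periods sm) :
    IsElliptic f :=
  ⟨hf, _, _, linearIndependent_periods, hp ▸ periods_mem (by simp), hp ▸ periods_mem (by simp)⟩

end Dixon

end

theorem mainTheorem2 :
    ∃ (c s : ℂ → ℂ) (K : ℝ),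
      -- `c` and `s` extend the unique holomorphic solution of the IVP on the initial disc
      (Dixon.SolvesIVP c s (ball 0 Dixon.r) ∧
        ∀ c₀ s₀ : ℂ → ℂ, Dixon.SolvesIVP c₀ s₀ (ball 0 Dixon.r) →
          EqOn c₀ c (ball 0 Dixon.r) ∧ EqOn s₀ s (ball 0 Dixon.r)) ∧
      -- `K` is the unique number in `(0, 2)` with `s (-K/2) = -1`
      (K ∈ Ioo (0 : ℝ) 2 ∧ s (-(K / 2)) = -1 ∧
        ∀ x ∈ Ioo (0 : ℝ) 2, s (-(x / 2)) = -1 → x = K) ∧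
      -- `c` and `s` are elliptic, with `c z = s (K - z)`
      Dixon.IsElliptic s ∧ Dixon.IsElliptic c ∧ (∀ z : ℂ, c z = s (K - z)) ∧
      -- Schwarz reflexion of `s` in each edge of the hexagon with vertices `±K, ±Kγ, ±Kγbar`
      (∀ ω ω' : ℂ, ω ^ 3 = 1 → ω' ^ 3 = 1 → ω ≠ ω' → ∀ z : ℂ,
        s (Dixon.reflect (K * ω) (-(K * ω')) z) = Dixon.reflect 0 ω (s z)) ∧
      -- periods, fundamental parallelogram and order
      (({3 * (K : ℂ), 3 * K * Dixon.γ, 3 * K * Dixon.γbar} : Set ℂ) ⊆ Dixon.periods s ∩ Dixon.periods c) ∧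
      Dixon.HasBasicPeriodsAndOrder s (3 * K * Dixon.γ) (3 * K * Dixon.γbar) 3 ∧
      Dixon.HasBasicPeriodsAndOrder c (3 * K * Dixon.γ) (3 * K * Dixon.γbar) 3 ∧
      Dixon.IsFundamentalDomain (Dixon.P K) (Dixon.periods s) ∧
      Dixon.IsFundamentalDomain (Dixon.P K) (Dixon.periods c) ∧
      -- poles of `s` in the parallelogram, and values of `s` along its edges
      Dixon.P K ∩ Dixon.poles s =
        {-(K : ℂ), 2 * K * Dixon.γ, 2 * K * Dixon.γbar,
          K * Dixon.γ - 2 * K, K * Dixon.γbar - 2 * K} ∧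
      (∀ z ∈ segment ℝ (0 : ℂ) (3 * K * Dixon.γ) ∪ segment ℝ (-3 * K : ℂ) (3 * K * Dixon.γbar),
        z ∉ Dixon.poles s → ∃ t : ℝ, s z = Dixon.γ * t) ∧
      (∀ z ∈ segment ℝ (0 : ℂ) (3 * K * Dixon.γbar) ∪ segment ℝ (-3 * K : ℂ) (3 * K * Dixon.γ),
        z ∉ Dixon.poles s → ∃ t : ℝ, s z = Dixon.γbar * t) ∧
      -- the slightly shifted parallelogram: simple poles with their residues, simple zeros
      (∀ᶠ ε : ℝ in 𝓝[>] 0,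
        Dixon.shiftedP K ε ∩ Dixon.poles s =
          {-(K : ℂ), 2 * K * Dixon.γ, 2 * K * Dixon.γbar} ∧
        Dixon.shiftedP K ε ∩ Dixon.zeros s =
          {0, -K + K * Dixon.γ, -K + K * Dixon.γbar}) ∧
      (∀ z ∈ Dixon.poles s, meromorphicOrderAt s z = -1) ∧
      (∀ z ∈ Dixon.zeros s, meromorphicOrderAt s z = 1) ∧
      Dixon.HasResidue s (-K) (-1) ∧
      Dixon.HasResidue s (2 * K * Dixon.γ) (-Dixon.γbar) ∧
      Dixon.HasResidue s (2 * K * Dixon.γbar) (-Dixon.γ) ∧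
      -- `c` and `s` have the same poles; off these the IVP and `c³ + s³ = 1` hold
      Dixon.poles c = Dixon.poles s ∧
      Dixon.SolvesIVP c s (Dixon.poles s)ᶜ ∧
      (∀ z ∉ Dixon.poles s, c z ^ 3 + s z ^ 3 = 1) := by
  open Dixon in
  have hper2 : -3 * (K₀ : ℂ) ∈ periods sm := mem_periods_sm.2
    ⟨1, 1, by push_cast; rw [γbar_eq]; ring⟩
  have hγbar : γbar ^ 3 = 1 := cube_eq_one_iff.2 (.inr (.inr rfl))
  -- for `a = K₀ (p γ + q γbar)` the residue `-χ (1 + a / K₀)` is `-γ ^ (p - q)`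
  have hres : ∀ {a ρ : ℂ} (p q : ℤ), a = K₀ * (p * γ + q * γbar) → 3 ∣ p + q - 2 →
      γ ^ (p - q) = ρ → HasResidue sm a (-ρ) := by
    rintro a ρ p q rfl hd rfl
    have := hasResidue_sm (isPolePt_intComb.2 hd)
    have e : 1 + K₀ * (p * γ + q * γbar) / (K₀ : ℂ) =
        ((p - 1 : ℤ) : ℂ) * γ + ((q - 1 : ℤ) : ℂ) * γbar := by
      rw [mul_div_cancel_left₀ _ K₀_ne_zero]; push_cast; rw [γbar_eq]; ring
    rwa [e, χ_intComb, sub_sub_sub_cancel_right] at this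
  have hball : SolvesIVP cm sm (ball 0 r) := solvesIVP.mono fun z hz h =>
    not_isPolePt_of_mem_ball hz (mem_poles_sm.1 h)
  have hε : ∀ᶠ ε : ℝ in 𝓝[>] 0, ε ∈ Ioo 0 K₀ := Ioo_mem_nhdsGT K₀_pos
  refine ⟨cm, sm, K₀, ⟨hball, fun c₀ s₀ h => ⟨fun z hz => (h.unique hball hz).1,
      fun z hz => (h.unique hball hz).2⟩⟩,
    ⟨⟨K₀_pos, K₀_lt_two⟩, sm_neg_half, fun x hx h => eq_K₀_of_sm_eq hx h⟩,
    isElliptic_of meromorphicNFOn_sm rfl, isElliptic_of meromorphicNFOn_cm periods_cm,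
    fun _ => rfl, fun ω ω' h h' hne z => sm_reflect h h' hne z,
    fun w hw => ⟨periods_mem hw, periods_cm ▸ periods_mem hw⟩,
    ⟨linearIndependent_periods, periods_sm, fun a => finsum_poles_cell
      (fun z hz => by rw [poleMultiplicity_sm, if_pos hz])
      (fun z hz => by rw [poleMultiplicity_sm, if_neg hz]) a⟩,
    ⟨linearIndependent_periods, periods_cm.trans periods_sm, fun a => finsum_poles_cell
      (fun z hz => by rw [poleMultiplicity_cm, if_pos hz])
      (fun z hz => by rw [poleMultiplicity_cm, if_neg hz]) a⟩,
    isFundamentalDomain_P, periods_cm ▸ isFundamentalDomain_P, P_inter_poles,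
    ?_, ?_, ?_, fun z hz => meromorphicOrderAt_sm_of_isPolePt (mem_poles_sm.1 hz),
    fun z hz => meromorphicOrderAt_sm_of_mem_zeros hz, ?_, ?_, ?_, poles_cm, solvesIVP,
    fun z hz => cm_cube_add_sm_cube (mt mem_poles_sm.2 hz)⟩
  · rintro z (hz | hz) -
    · exact exists_sm_eq_of_mem_segment γ_cube (mem_periods_sm.2 ⟨0, 0, by simp⟩)
        ⟨3 * K₀, by push_cast; ring⟩ hz
    · exact exists_sm_eq_of_mem_segment γ_cube hper2
        ⟨-3 * K₀, by push_cast; rw [γbar_eq]; ring⟩ hz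
  · rintro z (hz | hz) -
    · exact exists_sm_eq_of_mem_segment hγbar (mem_periods_sm.2 ⟨0, 0, by simp⟩)
        ⟨3 * K₀, by push_cast; ring⟩ hz
    · exact exists_sm_eq_of_mem_segment hγbar hper2
        ⟨-3 * K₀, by push_cast; rw [γbar_eq]; ring⟩ hz
  · filter_upwards [hε] with ε hε
    exact ⟨shiftedP_inter_poles hε, shiftedP_inter_zeros hε⟩
  · exact hres 1 1 (by push_cast; rw [γbar_eq]; ring) (by norm_num) (by norm_num)
  · refine hres 2 0 (by push_cast; ring) (by norm_num) ?_
    rw [← γ_sq_eq]; norm_cast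
  · refine hres 0 2 (by push_cast; ring) (by norm_num) ?_
    rw [γ_zpow_eq_of_dvd (n := 1) (by norm_num), zpow_one]
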